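/- There are universal constants $c_{\mathrm{lb}}>0$ and $C>0$ such that the following is true. Let $R\ge 1$ be real, $0<\gamma<1/2$, let $d,m\ge 1$ and $p,t\ge 0$ be integers with $$p\le \frac{1}{R}\min\Big(\frac{c_{\mathrm{lb}}}{\gamma^2},\,\exp(c_{\mathrm{lb}}\,d)\Big)\qquad\text{and}\qquad t\le \exp(c_{\mathrm{lb}}\,R\,d),$$ and let $\mathcal X$ be a domain of size $2m$. Let $\mathcal A$ be a randomized boosting algorithm over $\mathcal X$ that uses $m$ samples and has parallel complexity $(p,t)$: it receives a labelled sample $S\in(\mathcal X\times\{\pm1\})^m$, interacts with an oracle for $p$ rounds, sending in each round at most $t$ queries in parallel, each of which is a probability distribution over $S$ that may depend on $S$, on the internal randomness of $\mathcal A$ and on the answers of earlier rounds, and finally outputs an arbitrary hypothesis $\mathcal X\to\{\pm1\}$. For a distribution $\mathcal D$ on $\mathcal X\times\{\pm1\}$ write $\mathcal L_{\mathcal D}(h)=\Pr_{(x,y)\sim\mathcal D}[h(x)\ne y]$. Then there exist - a hypothesis class $\mathcal H\subseteq\{\pm1\}^{\mathcal X}$ of VC dimension $\min(\lfloor d/c_{\mathrm{lb}}\rfloor,\,2m)$,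 - a distribution $\mathcal D$ on $\mathcal X\times\{\pm1\}$ that is realizable by $\mathcal H$ (that is, $\mathcal L_{\mathcal D}(h)=0$ for some $h\in\mathcal H$), and - a $\gamma$-weak learner $\mathcal W$ for $\mathcal H$, that is, an oracle that answers every query distribution $\mathcal D'$ on $\mathcal X\times\{\pm1\}$ by some $h\in\mathcal H$ with $\mathcal L_{\mathcal D'}(h)\le\frac12-\gamma$, and declares failure only if no such $h$ exists, such that the output $\mathcal A^{\mathcal W}(S)$ of $\mathcal A$ with oracle $\mathcal W$ on $m$ i.i.d. samples satisfies $$\mathop{\mathbf E}_{S\sim\mathcal D^m,\ \mathcal A}\big[\mathcal L_{\mathcal D}(\mathcal A^{\mathcal W}(S))\big]\ \ge\ \exp\big(-C\,(p\,\gamma^2R+1)\big).$$ -/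

import Mathlib

open MeasureTheory

namespace ParallelBoosting

noncomputable section

/-- A probability distribution over labelled points `X × {±1}` with `X` finite, given by its
probability mass function. Labels are Booleans, `true` standing for `+1` and `false` for `-1`. -/
abbrev LabeledDist (X : Type*) [Fintype X] := ↥(stdSimplex ℝ (X × Bool))

/-- A hypothesis is a function `X → {±1}`. -/
abbrev Hypothesis (X : Type*) := X → Bool

section Learning

variable {X : Type*} [Fintype X]

/-- The loss `Pr_{(x, y) ∼ D} [h x ≠ y]`. -/
def loss (D : LabeledDist X) (h : Hypothesis X) : ℝ :=
  ∑ z : X × Bool, if h z.1 ≠ z.2 then D.1 z else 0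

/-- `D` is realizable by `H` if some hypothesis in `H` has zero loss on `D`. -/
def Realizable (H : Set (Hypothesis X)) (D : LabeledDist X) : Prop :=
  ∃ h ∈ H, loss D h = 0

/-- `H` shatters `S` if every labelling of `S` is the restriction of a member of `H`. -/
def Shatters {X : Type*} (H : Set (Hypothesis X)) (S : Finset X) : Prop :=
  ∀ f : Hypothesis X, ∃ h ∈ H, ∀ x ∈ S, h x = f x

/-- `H` has VC dimension `k`: the number `k` is the largest size of a set shattered by `H`. -/
def HasVCDim {X : Type*} (H : Set (Hypothesis X)) (k : ℕ) : Prop :=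
  IsGreatest {n : ℕ | ∃ S : Finset X, S.card = n ∧ Shatters H S} k

/-- An oracle that answers a query distribution with a hypothesis or with the
declaration of failure `none`. -/
abbrev Oracle (X : Type*) [Fintype X] := LabeledDist X → Option (Hypothesis X)

/-- `W` is a `γ`-weak learner with hypothesis set `H`: each hypothesis that it returns belongs
to `H` and has loss at most `1/2 - γ` on the query, and it declares failure only if `H` contains
no such hypothesis. -/
structure IsWeakLearner (γ : ℝ) (H : Set (Hypothesis X)) (W : Oracle X) : Prop where
  sound : ∀ (q : LabeledDist X) (h : Hypothesis X), W q = some h → h ∈ H ∧ loss q h ≤ 1 / 2 - γ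
  complete : ∀ q : LabeledDist X, W q = none → ∀ h ∈ H, ¬ loss q h ≤ 1 / 2 - γ

end Learning

/-- A randomized boosting algorithm over the domain `X` with sample complexity `m` and parallel
complexity `(p, t)`. The internal randomness is a point `ω` of `Ω`. In each round the
algorithm asks `t` queries, a set of fewer queries being listed with repetitions. The
queries of a round depend on the sample, on `ω` and on the list `past` of the answers to all
queries of the earlier rounds, and each of them is a distribution over the sample. After the last
round the algorithm outputs an arbitrary hypothesis. No bound is put on its running time, and it
sees the oracle only through the answers. -/
structure BoostingAlgorithm (Ω : Type*) [MeasurableSpace Ω] (X : Type*) [Fintype X]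
    (m p t : ℕ) where
  /-- The `j`-th query of the next round. -/
  query (S : Fin m → X × Bool) (past : List (Fin t → Option (Hypothesis X))) (j : Fin t) (ω : Ω) :
    LabeledDist X
  query_support : ∀ S past j ω z, (query S past j ω).1 z ≠ 0 → ∃ k, S k = z
  measurable_query : ∀ S past j, Measurable (query S past j)
  /-- The hypothesis returned after all rounds. -/
  output (S : Fin m → X × Bool) (past : List (Fin t → Option (Hypothesis X))) (ω : Ω) :
    Hypothesis X
  measurable_output : ∀ S past, Measurable (output S past)

namespace BoostingAlgorithm

variable {Ω : Type*} [MeasurableSpace Ω] {X : Type*} [Fintype X] {m p t : ℕ}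

/-- The answers that `A` has received from the oracle `W` in its first `n` rounds, in order. -/
def transcript (A : BoostingAlgorithm Ω X m p t) (W : Oracle X) (S : Fin m → X × Bool) (ω : Ω) :
    ℕ → List (Fin t → Option (Hypothesis X))
  | 0 => []
  | n + 1 => transcript A W S ω n ++ [fun j => W (A.query S (transcript A W S ω n) j ω)]

/-- The hypothesis that `A` returns on the sample `S` after `p` rounds of interaction
with the oracle `W`. -/
def run (A : BoostingAlgorithm Ω X m p t) (W : Oracle X) (S : Fin m → X × Bool) (ω : Ω) :
    Hypothesis X :=
  A.output S (A.transcript W S ω p) ω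

/-- The expected loss on `D` of the output of `A` with oracle `W`, over a sample of `m`
independent draws from `D` and, independently, the internal randomness of law `μ`. -/
def expectedLoss (A : BoostingAlgorithm Ω X m p t) (μ : Measure Ω) (D : LabeledDist X)
    (W : Oracle X) : ℝ :=
  ∑ S : Fin m → X × Bool, (∏ k, D.1 (S k)) * ∫ ω, loss D (A.run W S ω) ∂μ

end BoostingAlgorithm

end

end ParallelBoosting

open ParallelBoosting

namespace ParallelBoosting

open Finset

/-! The claimed bound never exceeds `exp (-4)`, so it suffices to force expected loss 1/32. Take a
uniformly random labelling `c` and the uniform distribution on points labelled by `c`. The class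
contains `c` and, for each round, a fresh block of independent random hypotheses: about `R` whose
values have correlation `6γ` with `c`, and about `5dR exp(650d)` uniform ones, which say nothing
about `c`. The oracle searches the blocks in order and the rest of the class last.

A concentrated query (much mass on few points, or a large square sum) admits a uniform hypothesis as
a weak one with probability at least `exp(-650d)`; for any other query a biased hypothesis fails
with probability at most `exp(-5d)` (`uniform_or_biased`). Either way a block fails a given query
with probability at most `exp(-5dR)` (`sum_blockLaw_fails_le`). A union bound applies, as the
queries of a round depend only on earlier blocks (`sum_blocksLaw_blockFails_le`). If no block fails,
the algorithm sees only the blocks (`transcript_eq_blockTranscript`).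

The blocks hide labels: flipping one label hardly changes their law, since `p R γ²` is small
(`le_sum_blocksLaw_ne`). At least half the domain is unsampled, so the average loss is at least
1/16, less 1/32 for failures (`le_sum_blocksLaw_loss`), and some `c` and blocks attain the average.
The blocks have only `exp(O(d))` members, so the VC dimension is small enough to be raised to the
prescribed value (`exists_superset_hasVCDim`). -/

/-! ### Biased random hypotheses: change of measure and tails. -/

/-- The product of two labels, as a sign. -/
noncomputable def agree (a b : Bool) : ℝ := if a = b then 1 else -1

/-- The probability of the label `b` under the law with correlation `θ` with the label `a`. -/
noncomputable def bias (θ : ℝ) (a b : Bool) : ℝ := (1 + θ * agree a b) / 2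

/-- The law of a random hypothesis with independent values, whose value at `x` has
correlation `θ x` with `c x`. -/
noncomputable def biasLaw {X : Type*} [Fintype X] (θ : X → ℝ) (c h : X → Bool) : ℝ :=
  ∏ x, bias (θ x) (c x) (h x)

/-- The correlation of `c` and `h` under the weights `w`. -/
noncomputable def corr {X : Type*} [Fintype X] (w : X → ℝ) (c h : X → Bool) : ℝ :=
  ∑ x, w x * agree (c x) (h x)

lemma agree_not (a b : Bool) : agree a (!b) = -agree a b := by
  cases a <;> cases b <;> simp [agree]

lemma sum_bias_mul (θ : ℝ) (a : Bool) (g : ℝ → ℝ) :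
    ∑ b, bias θ a b * g (agree a b) = (1 + θ) / 2 * g 1 + (1 - θ) / 2 * g (-1) := by
  cases a <;> simp only [Fintype.sum_bool, bias, agree, if_true, if_false, reduceCtorEq] <;> ring

lemma sum_bias (θ : ℝ) (a : Bool) : ∑ b, bias θ a b = 1 := by
  have := sum_bias_mul θ a (fun _ => 1)
  simp only [mul_one] at this
  rw [this]; ring

lemma bias_nonneg {θ : ℝ} (h0 : 0 ≤ θ) (h1 : θ ≤ 1) (a b : Bool) : 0 ≤ bias θ a b := by
  unfold bias agree; split_ifs <;> linarith

section

variable {X : Type*} [Fintype X]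

lemma sum_prod_fun [DecidableEq X] (g : X → Bool → ℝ) :
    ∑ h : X → Bool, ∏ x, g x (h x) = ∏ x, ∑ b, g x b :=
  (Fintype.prod_sum g).symm

lemma sum_biasLaw [DecidableEq X] (θ : X → ℝ) (c : X → Bool) : ∑ h, biasLaw θ c h = 1 := by
  unfold biasLaw
  rw [sum_prod_fun (fun x b => bias (θ x) (c x) b)]
  exact prod_eq_one fun x _ => sum_bias _ _

lemma biasLaw_nonneg {θ : X → ℝ} (h0 : ∀ x, 0 ≤ θ x) (h1 : ∀ x, θ x ≤ 1) (c h : X → Bool) :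
    0 ≤ biasLaw θ c h :=
  prod_nonneg fun x _ => bias_nonneg (h0 x) (h1 x) _ _

/-- Change of measure from the uniform law to a biased law. -/
lemma sq_sum_biasLaw_le [DecidableEq X] (θ : X → ℝ) (c : X → Bool) (E : Finset (X → Bool)) :
    (∑ h ∈ E, biasLaw θ c h) ^ 2 ≤ (∏ x, (1 + θ x ^ 2)) * ∑ h ∈ E, biasLaw 0 c h := by
  have key : ∀ h, biasLaw θ c h ^ 2 = (biasLaw θ c h ^ 2 / biasLaw 0 c h) * biasLaw 0 c h := by
    intro h
    have : biasLaw 0 c h ≠ 0 := prod_ne_zero_iff.2 fun x _ => by simp [bias]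
    field_simp
  have h0 : ∀ h, 0 ≤ biasLaw 0 c h := fun h =>
    biasLaw_nonneg (fun _ => le_rfl) (fun _ => zero_le_one) c h
  have h1 : ∀ h, 0 ≤ biasLaw θ c h ^ 2 / biasLaw 0 c h := fun h =>
    div_nonneg (sq_nonneg _) (h0 h)
  -- Cauchy–Schwarz; the first factor is the second moment of the density, which factorizes over the
  -- points.
  refine (sum_sq_le_sum_mul_sum_of_sq_le_mul E (fun h _ => h1 h) (fun h _ => h0 h)
    (fun h _ => (key h).le)).trans ?_
  refine mul_le_mul_of_nonneg_right ?_ (sum_nonneg fun h _ => h0 h)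
  refine (sum_le_univ_sum_of_nonneg h1).trans (le_of_eq ?_)
  have : ∀ h, biasLaw θ c h ^ 2 / biasLaw 0 c h =
      ∏ x, (bias (θ x) (c x) (h x) ^ 2 / bias 0 (c x) (h x)) := by
    intro h; simp [biasLaw, prod_div_distrib, prod_pow]
  simp_rw [this]
  rw [sum_prod_fun (fun x b => bias (θ x) (c x) b ^ 2 / bias 0 (c x) b)]
  refine prod_congr rfl fun x _ => ?_
  cases c x <;> simp [bias, agree] <;> ring

/-- Negating the hypothesis off `T` preserves this law. On its support the correlations of such a
pair add up to twice the mass of `T`, so one of them reaches `r`. -/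
lemma half_le_sum_biasLaw_of_symm [DecidableEq X] {w : X → ℝ} {c : X → Bool} {T : Finset X} {r : ℝ}
    (hw : r ≤ ∑ x ∈ T, w x) :
    1 / 2 ≤ ∑ h with r ≤ corr w c h, biasLaw (fun x => if x ∈ T then 1 else 0) c h := by
  set Q : (X → Bool) → ℝ := biasLaw (fun x => if x ∈ T then 1 else 0) c with hQ
  have hQ0 : ∀ h, 0 ≤ Q h := fun h => biasLaw_nonneg (fun x => by split_ifs <;> norm_num)
    (fun x => by split_ifs <;> norm_num) c h
  set φ : (X → Bool) → X → Bool := fun h x => if x ∈ T then h x else !h x with hφ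
  have hinv : Function.Involutive φ := by
    intro h; funext x; simp only [hφ]; split_ifs <;> simp
  have hQφ : ∀ h, Q (φ h) = Q h := by
    intro h
    refine prod_congr rfl fun x _ => ?_
    by_cases hx : x ∈ T <;> simp [hφ, hx, bias]
  have hsum : ∑ h, Q h = 1 := sum_biasLaw _ _
  rw [sum_filter]
  have h2 : ∑ h, (if r ≤ corr w c (φ h) then Q h else 0)
      = ∑ h, if r ≤ corr w c h then Q h else 0 := by
    rw [← Equiv.sum_comp hinv.toPerm (fun h => if r ≤ corr w c h then Q h else 0)]
    refine sum_congr rfl fun h _ => ?_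
    simp [hQφ]
  have h3 : ∀ h, Q h ≤ (if r ≤ corr w c h then Q h else 0)
      + (if r ≤ corr w c (φ h) then Q h else 0) := by
    intro h
    by_cases hz : ∀ x ∈ T, h x = c x
    · have e : corr w c h + corr w c (φ h) = 2 * ∑ x ∈ T, w x := by
        rw [corr, corr, ← sum_add_distrib, mul_sum, ← sum_filter_add_sum_filter_not univ (· ∈ T)]
        rw [sum_eq_zero (s := univ.filter (· ∉ T)), add_zero, filter_mem_eq_inter, univ_inter]
        · refine sum_congr rfl fun x hx => ?_
          simp [hφ, hx, agree, hz x hx]; ring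
        · intro x hx
          have hx : x ∉ T := (mem_filter.1 hx).2
          simp [hφ, hx, agree_not]
      have := hQ0 h
      by_cases ha : r ≤ corr w c h
      · rw [if_pos ha]; split_ifs <;> linarith
      · rw [if_neg ha, if_pos (by linarith)]; linarith
    · push Not at hz
      obtain ⟨x, hx, hne⟩ := hz
      have : Q h = 0 := by
        refine prod_eq_zero (mem_univ x) ?_
        simp [hx, bias, agree, Ne.symm hne]
      simp [this]
  have h4 := sum_le_sum fun h (_ : h ∈ univ) => h3 h
  rw [sum_add_distrib, h2, hsum] at h4
  linarith

/-- Second-order expansion of the exponential on `[-1, 1]`; the bias supplies the linear term. -/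
lemma sum_bias_mul_exp_le {θ : ℝ} (h0 : 0 ≤ θ) (h1 : θ ≤ 1) (a : Bool) {u : ℝ} (hu0 : 0 ≤ u)
    (hu1 : u ≤ 1) :
    ∑ b, bias θ a b * Real.exp (-u * agree a b) ≤ Real.exp (-u * θ + u ^ 2) := by
  rw [sum_bias_mul θ a (fun z => Real.exp (-u * z))]
  have e1 := (abs_le.1 (Real.abs_exp_sub_one_sub_id_le (x := -u * 1)
    (by rw [abs_le]; constructor <;> linarith))).2
  have e2 := (abs_le.1 (Real.abs_exp_sub_one_sub_id_le (x := -u * -1)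
    (by rw [abs_le]; constructor <;> linarith))).2
  have e3 := Real.add_one_le_exp (-u * θ + u ^ 2)
  nlinarith

lemma sum_bias_mul_exp_le_exp {θ : ℝ} (h0 : 0 ≤ θ) (a : Bool) {u : ℝ}
    (hu0 : 0 ≤ u) :
    ∑ b, bias θ a b * Real.exp (-u * agree a b) ≤ Real.exp u := by
  rw [sum_bias_mul θ a (fun z => Real.exp (-u * z))]
  have e1 : Real.exp (-u * 1) ≤ Real.exp u := Real.exp_le_exp.2 (by linarith)
  have e2 : Real.exp (-u * -1) = Real.exp u := by ring_nf
  rw [e2]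
  nlinarith

/-- An exponential Markov inequality for the lower tail of the correlation; the points of `T`
are estimated by the worst case. -/
lemma sum_biasLaw_corr_lt_le [DecidableEq X] {w θ : X → ℝ} (hw : ∀ x, 0 ≤ w x) (h0 : ∀ x, 0 ≤ θ x)
    (h1 : ∀ x, θ x ≤ 1) (c : X → Bool) (T : Finset X) {s r : ℝ} (hs : 0 ≤ s)
    (hsw : ∀ x ∉ T, s * w x ≤ 1) :
    ∑ h with corr w c h < r, biasLaw θ c h ≤
      Real.exp (s * (r + ∑ x ∈ T, w x) - s * (∑ x ∈ Tᶜ, w x * θ x)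
        + s ^ 2 * ∑ x ∈ Tᶜ, w x ^ 2) := by
  have hQ0 := biasLaw_nonneg h0 h1 c
  have step : ∑ h with corr w c h < r, biasLaw θ c h ≤
      ∑ h, Real.exp (s * r) * (biasLaw θ c h * Real.exp (-s * corr w c h)) := by
    rw [sum_filter]
    refine sum_le_sum fun h _ => ?_
    rw [mul_left_comm, ← Real.exp_add]
    split_ifs with hc
    · refine le_mul_of_one_le_right (hQ0 h) (Real.one_le_exp ?_)
      nlinarith
    · exact mul_nonneg (hQ0 h) (Real.exp_pos _).le
  refine step.trans ?_
  have : ∀ h, biasLaw θ c h * Real.exp (-s * corr w c h) =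
      ∏ x, (bias (θ x) (c x) (h x) * Real.exp (-(s * w x) * agree (c x) (h x))) := by
    intro h
    rw [prod_mul_distrib, ← Real.exp_sum, biasLaw, corr, mul_sum]
    congr 2
    exact sum_congr rfl fun x _ => by ring
  rw [← mul_sum]
  simp_rw [this]
  rw [sum_prod_fun (fun x b => bias (θ x) (c x) b * Real.exp (-(s * w x) * agree (c x) b))]
  have hb : ∏ x, ∑ b, bias (θ x) (c x) b * Real.exp (-(s * w x) * agree (c x) b) ≤
      (∏ x ∈ T, Real.exp (s * w x)) *
        ∏ x ∈ Tᶜ, Real.exp (-(s * w x) * θ x + (s * w x) ^ 2) := by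
    have hnn : ∀ x, 0 ≤ ∑ b, bias (θ x) (c x) b * Real.exp (-(s * w x) * agree (c x) b) :=
      fun x => sum_nonneg fun b _ => mul_nonneg (bias_nonneg (h0 x) (h1 x) _ _) (Real.exp_pos _).le
    rw [← prod_mul_prod_compl T]
    refine mul_le_mul ?_ ?_ (prod_nonneg fun x _ => hnn x)
      (prod_nonneg fun x _ => (Real.exp_pos _).le)
    · exact prod_le_prod (fun x _ => hnn x) fun x _ =>
        sum_bias_mul_exp_le_exp (h0 x) _ (mul_nonneg hs (hw x))
    · exact prod_le_prod (fun x _ => hnn x) fun x hx =>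
        sum_bias_mul_exp_le (h0 x) (h1 x) _ (mul_nonneg hs (hw x)) (hsw x (mem_compl.1 hx))
  refine (mul_le_mul_of_nonneg_left hb (Real.exp_pos _).le).trans (le_of_eq ?_)
  rw [← Real.exp_sum, ← Real.exp_sum, ← Real.exp_add, ← Real.exp_add, sum_add_distrib]
  congr 1
  simp only [mul_pow, neg_mul, mul_assoc, sum_neg_distrib, ← mul_sum]
  ring

/-! ### Weak hypotheses for a fixed query. -/

/-- This turns probability 1/2 under a biased law into a lower bound under the uniform one, with
`exp L` bounding the second moment of the density. The summand 2 in `hL` absorbs the factor 1/4. -/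
lemma exp_le_of_sq_le {L d a q : ℝ} {P K : ℝ} (hq : 1 / 2 ≤ q) (hP : q ^ 2 ≤ K * P)
    (hK : K ≤ Real.exp L) (hP0 : 0 ≤ P) (hL : L + 2 ≤ a * d) : Real.exp (-(a * d)) ≤ P := by
  have h2 : (4 : ℝ) ≤ Real.exp 2 := by
    have := Real.add_one_le_exp (1 : ℝ)
    have e : Real.exp 2 = Real.exp 1 * Real.exp 1 := by rw [← Real.exp_add]; norm_num
    rw [e]; nlinarith
  have h3 : 1 ≤ Real.exp (L + 2) * P := by
    rw [Real.exp_add]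
    have := mul_le_mul_of_nonneg_right hK hP0
    have h4 : 1 / 4 ≤ Real.exp L * P := by nlinarith
    nlinarith
  have h5 : Real.exp (L + 2) * P ≤ Real.exp (a * d) * P :=
    mul_le_mul_of_nonneg_right (Real.exp_le_exp.2 hL) hP0
  rw [Real.exp_neg]
  exact (inv_le_iff_one_le_mul₀' (Real.exp_pos _)).2 (h3.trans h5)

/-- Weights that put mass `r` on few points are positively correlated with a uniformly random
hypothesis with not too small probability. -/
lemma exp_le_sum_biasLaw_of_mass [DecidableEq X] {w : X → ℝ} {c : X → Bool} {T : Finset X}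
    {r : ℝ} {d : ℕ} (hd : 1 ≤ d) (hT : T.card ≤ 200 * d) (hw : r ≤ ∑ x ∈ T, w x) :
    Real.exp (-(650 * (d : ℝ))) ≤ ∑ h with r ≤ corr w c h, biasLaw 0 c h := by
  have hd' : (1 : ℝ) ≤ d := by exact_mod_cast hd
  refine exp_le_of_sq_le (L := 200 * d) (half_le_sum_biasLaw_of_symm hw)
    (sq_sum_biasLaw_le _ c _) ?_ (sum_nonneg fun h _ => biasLaw_nonneg (fun _ => le_rfl)
      (fun _ => zero_le_one) c h) (by linarith)
  have e : ∏ x, (1 + (if x ∈ T then (1 : ℝ) else 0) ^ 2) = 2 ^ T.card := by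
    rw [← prod_const, ← prod_subset (subset_univ T)]
    · exact prod_congr rfl fun x hx => by simp [hx]; norm_num
    · intro x _ hx; simp [hx]
  rw [e]
  have h2 : (2 : ℝ) ≤ Real.exp 1 := by
    have := Real.add_one_le_exp (1 : ℝ); linarith
  calc (2 : ℝ) ^ T.card ≤ Real.exp 1 ^ T.card := pow_le_pow_left₀ (by norm_num) h2 _
    _ = Real.exp T.card := by rw [← Real.exp_nat_mul, mul_one]
    _ ≤ _ := Real.exp_le_exp.2 (by exact_mod_cast hT)

/-- Weights with large square sum outside a set of little mass are positively correlated with a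
uniformly random hypothesis with not too small probability. -/
lemma exp_le_sum_biasLaw_of_sq_sum [DecidableEq X] {w : X → ℝ} (hw : ∀ x, 0 ≤ w x)
    {c : X → Bool} {T : Finset X} {γ : ℝ} {d : ℕ} (hd : 1 ≤ d) (hγ : 0 < γ)
    (hT : ∑ x ∈ T, w x ≤ 2 * γ) (hτ : ∀ x ∉ T, w x ≤ γ / (100 * d))
    (hv : γ ^ 2 / (20 * d) ≤ ∑ x ∈ Tᶜ, w x ^ 2) :
    Real.exp (-(650 * (d : ℝ))) ≤ ∑ h with 2 * γ ≤ corr w c h, biasLaw 0 c h := by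
  have hd' : (1 : ℝ) ≤ d := by exact_mod_cast hd
  set v := ∑ x ∈ Tᶜ, w x ^ 2 with hvdef
  have hv0 : 0 < v := lt_of_lt_of_le (by positivity) hv
  obtain ⟨ρ, hρ0, hρ⟩ : ∃ ρ : ℝ, 0 < ρ ∧ ρ ^ 2 = v :=
    ⟨√v, Real.sqrt_pos.2 hv0, Real.sq_sqrt hv0.le⟩
  have hγv : γ ^ 2 ≤ 20 * d * v := by
    rw [div_le_iff₀ (by positivity)] at hv; linarith
  have hγρ : γ ≤ 5 * d * ρ := by
    refine (pow_le_pow_iff_left₀ hγ.le (by positivity) two_ne_zero).1 ?_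
    calc γ ^ 2 ≤ 20 * d * v := hγv
      _ ≤ 20 * (d * d) * v := by gcongr; nlinarith
      _ ≤ (5 * d * ρ) ^ 2 := by rw [← hρ]; nlinarith [mul_pos (mul_pos hρ0 hρ0) (mul_pos (lt_of_lt_of_le one_pos hd') (lt_of_lt_of_le one_pos hd'))]
  -- The tilt is proportional to the weight. The resulting mean `4γ + 2ρ` covers the threshold `2γ`
  -- and a worst-case loss of `2γ` on `T`; the surplus `2ρ` beats the square sum `ρ²`, giving tail
  -- exponent -1 at `s = 1/ρ`.
  set lam := (4 * γ + 2 * ρ) / v with hlam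
  have hlam0 : 0 < lam := by positivity
  have hwρ : ∀ x ∉ T, w x ≤ ρ / 20 := fun x hx => by
    refine (hτ x hx).trans ?_
    rw [div_le_iff₀ (by positivity)]; nlinarith
  have hlw : ∀ x ∉ T, lam * w x ≤ 1 := fun x hx => by
    rw [hlam, div_mul_eq_mul_div, div_le_one hv0]
    have h1 : 4 * γ * w x ≤ 4 / 5 * v := by
      have h1 := mul_le_mul_of_nonneg_left (hτ x hx) (by positivity : 0 ≤ 4 * γ)
      have h2 : 4 * γ * (γ / (100 * d)) = 4 * γ ^ 2 / (100 * d) := by ring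
      rw [h2] at h1
      refine h1.trans ?_
      rw [div_le_iff₀ (by positivity)]; linarith
    have h2 : 2 * ρ * w x ≤ v / 10 := by rw [← hρ]; nlinarith [hwρ x hx]
    linarith
  set θ : X → ℝ := fun x => if x ∈ T then 0 else lam * w x with hθ
  have h0 : ∀ x, 0 ≤ θ x := fun x => by
    simp only [hθ]; split_ifs; exacts [le_rfl, mul_nonneg hlam0.le (hw x)]
  have h1 : ∀ x, θ x ≤ 1 := fun x => by
    simp only [hθ]; split_ifs with h; exacts [zero_le_one, hlw x h]
  have hlv : lam * v = 4 * γ + 2 * ρ := div_mul_cancel₀ _ hv0.ne'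
  have hmean : ∑ x ∈ Tᶜ, w x * θ x = 4 * γ + 2 * ρ := by
    rw [← hlv, hvdef, mul_sum]
    exact sum_congr rfl fun x hx => by simp only [hθ, if_neg (mem_compl.1 hx)]; ring
  have htail := sum_biasLaw_corr_lt_le hw h0 h1 c T (s := 1 / ρ) (r := 2 * γ) (by positivity)
    (fun x hx => by
      rw [one_div_mul_eq_div, div_le_one hρ0]; linarith [hwρ x hx])
  rw [hmean, ← hvdef] at htail
  have hexp : 1 / ρ * (2 * γ + ∑ x ∈ T, w x) - 1 / ρ * (4 * γ + 2 * ρ) + (1 / ρ) ^ 2 * v ≤ -1 := by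
    have : 1 / ρ * (2 * γ + ∑ x ∈ T, w x) ≤ 1 / ρ * (4 * γ) :=
      mul_le_mul_of_nonneg_left (by linarith) (by positivity)
    have e : (1 / ρ) ^ 2 * v = 1 := by rw [← hρ]; field_simp
    have e' : 1 / ρ * (4 * γ + 2 * ρ) = 1 / ρ * (4 * γ) + 2 := by field_simp
    linarith
  have hhalf : Real.exp (-1) ≤ 1 / 2 := by
    rw [Real.exp_neg, one_div]
    have := Real.add_one_le_exp (1 : ℝ)
    exact inv_anti₀ two_pos (by linarith)
  have hsplit := sum_filter_add_sum_filter_not univ (fun h => corr w c h < 2 * γ) (biasLaw θ c)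
  rw [sum_biasLaw] at hsplit
  simp only [not_lt] at hsplit
  have hq : 1 / 2 ≤ ∑ h with 2 * γ ≤ corr w c h, biasLaw θ c h := by
    have := htail.trans ((Real.exp_le_exp.2 hexp).trans hhalf)
    linarith
  -- The cost of the tilt is `(4γ + 2ρ)² / v ≤ 32γ² / v + 8`, where `γ² / v ≤ 20d`.
  refine exp_le_of_sq_le (L := 648 * d) hq
    (sq_sum_biasLaw_le _ c _) ?_ (sum_nonneg fun h _ => biasLaw_nonneg (fun _ => le_rfl)
      (fun _ => zero_le_one) c h) (by linarith)
  have hsq : ∑ x, θ x ^ 2 = lam ^ 2 * v := by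
    rw [hvdef, mul_sum, ← sum_subset (subset_univ Tᶜ)]
    · exact sum_congr rfl fun x hx => by simp only [hθ, if_neg (mem_compl.1 hx)]; ring
    · intro x _ hx
      have : x ∈ T := by simpa using hx
      simp [hθ, this]
  calc ∏ x, (1 + θ x ^ 2) ≤ ∏ x, Real.exp (θ x ^ 2) :=
        prod_le_prod (fun x _ => by positivity) fun x _ => by
          rw [add_comm]; exact Real.add_one_le_exp _
    _ = Real.exp (lam ^ 2 * v) := by rw [← Real.exp_sum, hsq]
    _ ≤ _ := Real.exp_le_exp.2 ?_
  have e : lam ^ 2 * v * v = (4 * γ + 2 * ρ) ^ 2 := by rw [← hlv]; ring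
  have h8 : (4 * γ + 2 * ρ) ^ 2 ≤ 32 * γ ^ 2 + 8 * v := by
    rw [← hρ]; nlinarith [sq_nonneg (4 * γ - 2 * ρ)]
  refine le_of_mul_le_mul_right ?_ hv0
  rw [e]
  nlinarith

/-- Few uniformly random hypotheses contain a weak hypothesis for the weights `w`, or else a
slightly biased hypothesis is weak with high probability. -/
lemma uniform_or_biased [DecidableEq X] {w : X → ℝ} (hw : ∀ x, 0 ≤ w x) (hw1 : ∑ x, w x = 1)
    (c : X → Bool) {γ : ℝ} {d : ℕ} (hd : 1 ≤ d) (hγ : 0 < γ) (hγ1 : γ ≤ 1 / 12) :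
    Real.exp (-(650 * (d : ℝ))) ≤ ∑ h with 2 * γ ≤ corr w c h, biasLaw 0 c h ∨
    ∑ h with corr w c h < 2 * γ, biasLaw (fun _ => 6 * γ) c h ≤ Real.exp (-(5 * (d : ℝ))) := by
  have hd' : (1 : ℝ) ≤ d := by exact_mod_cast hd
  -- With this cutoff, `200d` heavy points carry mass `2γ`, and light points have `s * w x ≤ 1/10`
  -- for `s = 10d/γ` used below.
  set T : Finset X := univ.filter fun x => γ / (100 * d) < w x with hTdef
  have hτ : ∀ x ∉ T, w x ≤ γ / (100 * d) := fun x hx => by simpa [hTdef] using hx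
  by_cases hbig : 200 * d ≤ T.card
  · left
    obtain ⟨T', hT'T, hT'⟩ := exists_subset_card_eq hbig
    refine exp_le_sum_biasLaw_of_mass hd hT'.le ?_
    have : ∀ x ∈ T', γ / (100 * d) ≤ w x := fun x hx => (mem_filter.1 (hT'T hx)).2.le
    have := card_nsmul_le_sum T' w _ this
    rw [hT', nsmul_eq_mul] at this
    refine le_trans (le_of_eq ?_) this
    push_cast
    field_simp
    norm_num
  push Not at hbig
  by_cases hmass : 2 * γ ≤ ∑ x ∈ T, w x
  · exact Or.inl (exp_le_sum_biasLaw_of_mass hd hbig.le hmass)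
  push Not at hmass
  by_cases hv : γ ^ 2 / (20 * d) ≤ ∑ x ∈ Tᶜ, w x ^ 2
  · exact Or.inl (exp_le_sum_biasLaw_of_sq_sum hw hd hγ hmass.le hτ hv)
  push Not at hv
  right
  -- Here `T` has mass below `2γ`. The linear part of the exponent is at most `s * (-γ) = -10d` (`γ
  -- ≤ 1/12` absorbs the `12γ²`), and the quadratic part at most `5d`.
  refine (sum_biasLaw_corr_lt_le hw (fun _ => by positivity) (fun _ => by linarith) c T
    (s := 10 * d / γ) (r := 2 * γ) (by positivity) ?_).trans (Real.exp_le_exp.2 ?_)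
  · intro x hx
    have := mul_le_mul_of_nonneg_left (hτ x hx) (by positivity : 0 ≤ 10 * d / γ)
    refine this.trans ?_
    have e : 10 * d / γ * (γ / (100 * d)) = 1 / 10 := by field_simp; norm_num
    rw [e]; norm_num
  · have hrest : ∑ x ∈ Tᶜ, w x * (6 * γ) = (1 - ∑ x ∈ T, w x) * (6 * γ) := by
      rw [← sum_mul, ← hw1, ← sum_add_sum_compl T w]; ring
    rw [hrest, ← mul_sub]
    have h1 : (10 * d / γ) ^ 2 * ∑ x ∈ Tᶜ, w x ^ 2 ≤ 5 * d := by
      refine (mul_le_mul_of_nonneg_left hv.le (by positivity)).trans (le_of_eq ?_)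
      field_simp; norm_num
    have h2 : 10 * d / γ * (2 * γ + ∑ x ∈ T, w x - (1 - ∑ x ∈ T, w x) * (6 * γ))
        ≤ 10 * d / γ * (-γ) := by
      refine mul_le_mul_of_nonneg_left ?_ (by positivity)
      nlinarith
    have e : 10 * d / γ * (-γ) = -(10 * d) := by field_simp
    linarith

end

/-! ### Prescribing the VC dimension. -/

section

variable {X : Type*}

lemma Shatters.two_pow_card_le [Finite X] {H : Set (Hypothesis X)} {S : Finset X}
    (h : Shatters H S) : 2 ^ S.card ≤ H.ncard := by
  classical
  have hsurj : Function.Surjective fun (g : H) (x : S) => g.1 x := by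
    intro f
    obtain ⟨g, hg, hgf⟩ := h fun x => if hx : x ∈ S then f ⟨x, hx⟩ else false
    exact ⟨⟨g, hg⟩, funext fun x => by simp [hgf x x.2]⟩
  have := Nat.card_le_card_of_surjective _ hsurj
  simpa using this

/-- One additional hypothesis raises the VC dimension by at most one. -/
lemma Shatters.of_insert [DecidableEq X] {H : Set (Hypothesis X)} {S : Finset X}
    {h : Hypothesis X} (hS : Shatters (insert h H) S) {x : X} (hx : x ∈ S) :
    Shatters H (S.erase x) := by
  intro f
  obtain ⟨g, hg, hgf⟩ := hS (Function.update f x (!h x))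
  refine ⟨g, hg.resolve_left ?_, fun y hy => ?_⟩
  · rintro rfl
    simpa using hgf x hx
  · rw [hgf y (mem_of_mem_erase hy), Function.update_of_ne (ne_of_mem_erase hy)]

/-- A class of hypotheses extends to a class of any larger VC dimension. -/
lemma exists_superset_hasVCDim [Fintype X] {H : Set (Hypothesis X)} {k : ℕ}
    (hk : k ≤ Fintype.card X) (hH : ∀ S : Finset X, Shatters H S → S.card ≤ k) :
    ∃ H', H ⊆ H' ∧ HasVCDim H' k := by
  classical
  -- In a maximal extension, adding any missing hypothesis shatters more than `k` points; removing
  -- one of these points leaves at least `k` that are shattered without it.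
  obtain ⟨H', ⟨hHH', hH'⟩, hmax⟩ := Set.Finite.exists_maximal
    (Set.toFinite {H' : Set (Hypothesis X) | H ⊆ H' ∧ ∀ S : Finset X, Shatters H' S → S.card ≤ k})
    ⟨H, le_rfl, hH⟩
  have hbound : k ∈ upperBounds {n : ℕ | ∃ S : Finset X, S.card = n ∧ Shatters H' S} := by
    rintro n ⟨S, rfl, hS⟩; exact hH' S hS
  refine ⟨H', hHH', ?_, hbound⟩
  suffices ∃ S : Finset X, k ≤ S.card ∧ Shatters H' S by
    obtain ⟨S, hkS, hS⟩ := this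
    exact ⟨S, le_antisymm (hH' S hS) hkS, hS⟩
  by_cases huniv : ∀ h, h ∈ H'
  · exact ⟨univ, by simpa using hk, fun f => ⟨f, huniv f, fun _ _ => rfl⟩⟩
  push Not at huniv
  obtain ⟨h, hh⟩ := huniv
  have hins : ∃ S : Finset X, Shatters (insert h H') S ∧ k < S.card := by
    by_contra! hcon
    exact hh (hmax ⟨hHH'.trans (Set.subset_insert _ _), hcon⟩ (Set.subset_insert _ _)
      (Set.mem_insert _ _))
  obtain ⟨S, hS, hkS⟩ := hins
  obtain ⟨x, hx⟩ : S.Nonempty := card_pos.1 (by omega)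
  exact ⟨S.erase x, by rw [card_erase_of_mem hx]; omega, hS.of_insert hx⟩

end

/-! ### Blocks of hypotheses and the unpredictability of a label. -/

/-- The labelling `c` with the label of `x` flipped. -/
def flipAt {X : Type*} [DecidableEq X] (x : X) (c : X → Bool) : X → Bool := Function.update c x (!c x)

lemma flipAt_involutive {X : Type*} [DecidableEq X] (x : X) : Function.Involutive (flipAt x) := by
  intro c; funext y; by_cases h : y = x
  · subst h; simp [flipAt]
  · simp [flipAt, h]

section

variable {X J : Type*} [Fintype X] [Fintype J]

/-- The law of a block of independent random hypotheses, of which the `j`-th has correlation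
`θ j` with `c` at each point. -/
noncomputable def blockLaw (θ : J → ℝ) (c : X → Bool) (b : J → X → Bool) : ℝ :=
  ∏ j, biasLaw (fun _ => θ j) c (b j)

/-- The law of `p` independent blocks of random hypotheses. -/
noncomputable def blocksLaw {p : ℕ} (θ : J → ℝ) (c : X → Bool) (B : Fin p → J → X → Bool) : ℝ :=
  ∏ k, blockLaw θ c (B k)

lemma blockLaw_nonneg {θ : J → ℝ} (h0 : ∀ j, 0 ≤ θ j) (h1 : ∀ j, θ j ≤ 1) (c : X → Bool)
    (b : J → X → Bool) : 0 ≤ blockLaw θ c b :=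
  prod_nonneg fun j _ => biasLaw_nonneg (fun _ => h0 j) (fun _ => h1 j) c _

lemma blocksLaw_nonneg {p : ℕ} {θ : J → ℝ} (h0 : ∀ j, 0 ≤ θ j) (h1 : ∀ j, θ j ≤ 1)
    (c : X → Bool) (B : Fin p → J → X → Bool) : 0 ≤ blocksLaw θ c B :=
  prod_nonneg fun _ _ => blockLaw_nonneg h0 h1 c _

variable [DecidableEq X] [DecidableEq J]

lemma sum_blockLaw (θ : J → ℝ) (c : X → Bool) : ∑ b, blockLaw θ c b = 1 := by
  unfold blockLaw
  rw [← Fintype.prod_sum (fun j h => biasLaw (fun _ => θ j) c h)]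
  exact prod_eq_one fun j _ => sum_biasLaw _ _

lemma sum_blocksLaw {p : ℕ} (θ : J → ℝ) (c : X → Bool) :
    ∑ B : Fin p → J → X → Bool, blocksLaw θ c B = 1 := by
  unfold blocksLaw
  rw [← Fintype.prod_sum (fun _ b => blockLaw θ c b)]
  exact prod_eq_one fun j _ => sum_blockLaw _ _

/-- A coordinate of a product law may be replaced by an independent copy. -/
lemma sum_prod_mul_eq_sum_update {ι β : Type*} [Fintype ι] [DecidableEq ι] [Fintype β]
    {V : β → ℝ} (hV : ∑ b, V b = 1) (k : ι) (g : (ι → β) → ℝ) :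
    ∑ B : ι → β, (∏ i, V (B i)) * g B =
      ∑ B : ι → β, (∏ i, V (B i)) * ∑ b, V b * g (Function.update B k b) := by
  -- Swapping the coordinate with its copy preserves the joint law.
  set φ : (ι → β) × β → (ι → β) × β := fun z => (Function.update z.1 k z.2, z.1 k) with hφ
  have hinv : Function.Involutive φ := fun z => by simp [hφ]
  have hW : ∀ z : (ι → β) × β,
      (∏ i, V (Function.update z.1 k z.2 i)) * V (z.1 k) = (∏ i, V (z.1 i)) * V z.2 := by
    intro z
    rw [← mul_prod_erase univ _ (mem_univ k), ← mul_prod_erase univ _ (mem_univ k),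
      Function.update_self]
    have : ∏ i ∈ univ.erase k, V (Function.update z.1 k z.2 i) = ∏ i ∈ univ.erase k, V (z.1 i) :=
      prod_congr rfl fun i hi => by rw [Function.update_of_ne (ne_of_mem_erase hi)]
    rw [this]; ring
  calc ∑ B : ι → β, (∏ i, V (B i)) * g B
      = ∑ z : (ι → β) × β, (∏ i, V (z.1 i)) * V z.2 * g z.1 := by
        rw [Fintype.sum_prod_type]
        refine sum_congr rfl fun B _ => ?_
        simp only
        rw [← sum_mul, ← mul_sum, hV, mul_one]
    _ = ∑ z : (ι → β) × β, (∏ i, V (z.1 i)) * V z.2 * g (Function.update z.1 k z.2) := by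
        rw [← Equiv.sum_comp hinv.toPerm]
        refine sum_congr rfl fun z _ => ?_
        simp only [Function.Involutive.coe_toPerm, hφ]
        rw [hW]
    _ = _ := by
        rw [Fintype.sum_prod_type]
        refine sum_congr rfl fun B _ => ?_
        rw [mul_sum]
        exact sum_congr rfl fun b _ => by ring

lemma sum_blocksLaw_mul_eq_sum_update {p : ℕ} (θ : J → ℝ) (c : X → Bool) (k : Fin p)
    (g : (Fin p → J → X → Bool) → ℝ) :
    ∑ B, blocksLaw θ c B * g B =
      ∑ B, blocksLaw θ c B * ∑ b, blockLaw θ c b * g (Function.update B k b) :=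
  sum_prod_mul_eq_sum_update (sum_blockLaw θ c) k g

/-- The affinity of the laws of the blocks for two labellings that differ at one point. -/
lemma sum_sqrt_blocksLaw {p : ℕ} {θ : J → ℝ} (h0 : ∀ j, 0 ≤ θ j) (h1 : ∀ j, θ j ≤ 1)
    (c : X → Bool) (x : X) :
    ∑ B : Fin p → J → X → Bool, √(blocksLaw θ c B) * √(blocksLaw θ (flipAt x c) B) =
      ∏ _k : Fin p, ∏ j, √(1 - θ j ^ 2) := by
  have e : ∀ B : Fin p → J → X → Bool, √(blocksLaw θ c B) * √(blocksLaw θ (flipAt x c) B) =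
      ∏ k, ∏ j, ∏ y, (√(bias (θ j) (c y) (B k j y)) * √(bias (θ j) (flipAt x c y) (B k j y))) := by
    intro B
    have : ∀ c : X → Bool, √(blocksLaw θ c B) = ∏ k, ∏ j, ∏ y, √(bias (θ j) (c y) (B k j y)) := by
      intro c
      have hb : ∀ k j y, 0 ≤ bias (θ j) (c y) (B k j y) := fun k j y => bias_nonneg (h0 j) (h1 j) _ _
      rw [Real.sqrt_eq_iff_mul_self_eq
        (blocksLaw_nonneg h0 h1 c B) (prod_nonneg fun k _ => prod_nonneg fun j _ =>
          prod_nonneg fun y _ => Real.sqrt_nonneg _)]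
      simp_rw [← prod_mul_distrib, Real.mul_self_sqrt (hb _ _ _)]
      rfl
    simp_rw [this, ← prod_mul_distrib]
  simp_rw [e]
  rw [← Fintype.prod_sum (fun (_ : Fin p) (b : J → X → Bool) => ∏ j, ∏ y,
    (√(bias (θ j) (c y) (b j y)) * √(bias (θ j) (flipAt x c y) (b j y))))]
  refine prod_congr rfl fun k _ => ?_
  rw [← Fintype.prod_sum (fun (j : J) (h : X → Bool) => ∏ y,
    (√(bias (θ j) (c y) (h y)) * √(bias (θ j) (flipAt x c y) (h y))))]
  refine prod_congr rfl fun j _ => ?_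
  rw [← Fintype.prod_sum (fun (y : X) (b : Bool) =>
    (√(bias (θ j) (c y) b) * √(bias (θ j) (flipAt x c y) b)))]
  -- The two laws agree away from `x`, where each factor is a total mass of 1.
  rw [← mul_prod_erase univ _ (mem_univ x), prod_eq_one (s := univ.erase x), mul_one]
  · simp_rw [← Real.sqrt_mul (bias_nonneg (h0 j) (h1 j) _ _)]
    have : ∀ b, bias (θ j) (c x) b * bias (θ j) (flipAt x c x) b = (1 - θ j ^ 2) / 2 ^ 2 := by
      intro b
      cases b <;> cases h : c x <;> simp [flipAt, h, bias, agree] <;> ring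
    simp_rw [this]
    rw [Real.sqrt_div' _ (by positivity), Real.sqrt_sq (by norm_num)]
    simp only [sum_const, card_univ, Fintype.card_bool, nsmul_eq_mul]
    push_cast
    ring
  · intro y hy
    have : flipAt x c y = c y := by simp [flipAt, ne_of_mem_erase hy]
    simp_rw [this, Real.mul_self_sqrt (bias_nonneg (h0 j) (h1 j) _ _)]
    exact sum_bias _ _

/-- The label of a point cannot be predicted well from the blocks and the other labels. -/
lemma le_sum_blocksLaw_ne {p : ℕ} {θ : J → ℝ} (h0 : ∀ j, 0 ≤ θ j) (h1 : ∀ j, θ j ≤ 1) (x : X)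
    (out : (X → Bool) → (Fin p → J → X → Bool) → Bool)
    (hout : ∀ c B, out (flipAt x c) B = out c B) :
    2 ^ Fintype.card X * ((∏ j, (1 - θ j ^ 2)) ^ p / 4) ≤
      ∑ c : X → Bool, ∑ B, blocksLaw θ c B * if out c B ≠ c x then 1 else 0 := by
  set f : (X → Bool) → ℝ := fun c => ∑ B, blocksLaw θ c B * if out c B ≠ c x then 1 else 0 with hf
  -- Le Cam's two-point method: if `a` is the sum of the two error probabilities, the complementary
  -- sum is `2 - a`, and Cauchy–Schwarz bounds the squared affinity by `a * (2 - a) ≤ 2 * a`.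
  have hpair : ∀ c, (∏ j, (1 - θ j ^ 2)) ^ p / 2 ≤ f c + f (flipAt x c) := by
    intro c
    set W := fun B : Fin p → J → X → Bool => blocksLaw θ c B with hWd
    set W' := fun B : Fin p → J → X → Bool => blocksLaw θ (flipAt x c) B with hWd'
    have hW : ∀ B, 0 ≤ W B := blocksLaw_nonneg h0 h1 c
    have hW' : ∀ B, 0 ≤ W' B := blocksLaw_nonneg h0 h1 (flipAt x c)
    have hflip : flipAt x c x = !c x := by simp [flipAt]
    have hff : f c + f (flipAt x c) = ∑ B, if out c B ≠ c x then W B else W' B := by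
      simp only [hf]
      rw [← sum_add_distrib]
      refine sum_congr rfl fun B _ => ?_
      rw [hout, hflip]
      cases out c B <;> cases c x <;> simp [hWd, hWd']
    set g := ∑ B, if out c B ≠ c x then W' B else W B with hg
    have hsum : (f c + f (flipAt x c)) + g = 2 := by
      rw [hff, hg, ← sum_add_distrib]
      have : ∀ B, ((if out c B ≠ c x then W B else W' B) + if out c B ≠ c x then W' B else W B)
          = W B + W' B := by
        intro B; split_ifs <;> ring
      simp_rw [this]
      rw [sum_add_distrib, hWd, hWd', sum_blocksLaw, sum_blocksLaw]; norm_num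
    have hcs : (∑ B, √(W B) * √(W' B)) ^ 2 ≤ (f c + f (flipAt x c)) * g := by
      rw [hff, hg]
      refine sum_sq_le_sum_mul_sum_of_sq_le_mul _ (fun B _ => ?_) (fun B _ => ?_) fun B _ => ?_
      · split_ifs; exacts [hW B, hW' B]
      · split_ifs; exacts [hW' B, hW B]
      · rw [mul_pow, Real.sq_sqrt (hW B), Real.sq_sqrt (hW' B)]
        split_ifs
        · exact le_rfl
        · exact (mul_comm _ _).le
    have hθ : ∀ j, 0 ≤ 1 - θ j ^ 2 := fun j => by nlinarith [h0 j, h1 j]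
    rw [hWd, hWd', sum_sqrt_blocksLaw h0 h1] at hcs
    have e : (∏ _k : Fin p, ∏ j, √(1 - θ j ^ 2)) ^ 2 = (∏ j, (1 - θ j ^ 2)) ^ p := by
      rw [prod_const, card_univ, Fintype.card_fin, ← pow_mul, mul_comm p 2, pow_mul, ← prod_pow]
      congr 1
      exact prod_congr rfl fun j _ => Real.sq_sqrt (hθ j)
    rw [e] at hcs
    have hfnn : 0 ≤ f c + f (flipAt x c) := by
      rw [hff]; exact sum_nonneg fun B _ => by split_ifs; exacts [hW B, hW' B]
    nlinarith
  have h2 : ∑ c, f (flipAt x c) = ∑ c, f c := Equiv.sum_comp (flipAt_involutive x).toPerm f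
  have h3 := sum_le_sum fun c (_ : c ∈ univ) => hpair c
  rw [sum_add_distrib, h2, sum_const, card_univ, nsmul_eq_mul] at h3
  simp only [Fintype.card_pi, Fintype.card_bool, prod_const, card_univ] at h3
  push_cast at h3
  change _ ≤ ∑ c, f c
  linarith

end

/-! ### The oracle and its simulation by the blocks. -/

section

variable {X J : Type*} [Fintype J]

/-- The hypotheses of the first `n` blocks, in order. -/
noncomputable def firstBlocks {p : ℕ} (B : Fin p → J → Hypothesis X) (n : ℕ) :
    List (Hypothesis X) :=
  ((List.ofFn B).take n).flatMap fun b => univ.toList.map b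

lemma mem_firstBlocks_succ {p : ℕ} (B : Fin p → J → Hypothesis X) (k : Fin p) (j : J) :
    B k j ∈ firstBlocks B (k + 1) := by
  unfold firstBlocks
  rw [List.mem_flatMap]
  refine ⟨B k, ?_, by simp⟩
  rw [List.mem_take_iff_getElem]
  exact ⟨k, by simp, by simp⟩

lemma firstBlocks_subset {p : ℕ} {B : Fin p → J → Hypothesis X} {n : ℕ} {h : Hypothesis X}
    (hh : h ∈ firstBlocks B n) : ∃ k j, B k j = h := by
  obtain ⟨b, hb, hh⟩ := List.mem_flatMap.1 hh
  obtain ⟨k, rfl⟩ := (List.mem_ofFn' _ _).1 (List.mem_of_mem_take hb)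
  obtain ⟨j, -, rfl⟩ := List.mem_map.1 hh
  exact ⟨k, j, rfl⟩

lemma firstBlocks_congr {p : ℕ} {B B' : Fin p → J → Hypothesis X} {n : ℕ}
    (h : ∀ k : Fin p, k.1 < n → B k = B' k) : firstBlocks B n = firstBlocks B' n := by
  unfold firstBlocks
  congr 1
  refine List.ext_getElem (by simp) fun i h1 h2 => ?_
  simp only [List.length_take, List.length_ofFn, lt_min_iff] at h1
  simpa using h ⟨i, h1.2⟩ h1.1

lemma firstBlocks_prefix {p : ℕ} (B : Fin p → J → Hypothesis X) {n n' : ℕ} (h : n ≤ n') :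
    ∃ l, firstBlocks B n' = firstBlocks B n ++ l := by
  unfold firstBlocks
  obtain ⟨l, hl⟩ := List.take_prefix_take_left (l := List.ofFn B) h
  exact ⟨l.flatMap fun b => univ.toList.map b, by rw [← hl, List.flatMap_append]⟩

variable [Fintype X]

lemma loss_nonneg (D : LabeledDist X) (h : Hypothesis X) : 0 ≤ loss D h :=
  sum_nonneg fun z _ => by split_ifs; exacts [D.2.1 z, le_rfl]

lemma loss_le_one (D : LabeledDist X) (h : Hypothesis X) : loss D h ≤ 1 := by
  rw [← D.2.2]
  exact sum_le_sum fun z _ => by split_ifs; exacts [le_rfl, D.2.1 z]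

open Classical in
/-- The oracle that answers with the first hypothesis of `l` whose loss is at most `1/2 - γ`. -/
noncomputable def firstWeak (γ : ℝ) (l : List (Hypothesis X)) : Oracle X :=
  fun q => l.find? fun h => decide (loss q h ≤ 1 / 2 - γ)

lemma firstWeak_sound {γ : ℝ} {l : List (Hypothesis X)} {q : LabeledDist X} {h : Hypothesis X}
    (hh : firstWeak γ l q = some h) : h ∈ l ∧ loss q h ≤ 1 / 2 - γ :=
  ⟨List.mem_of_find?_eq_some hh, by simpa using List.find?_some hh⟩

lemma firstWeak_complete {γ : ℝ} {l : List (Hypothesis X)} {q : LabeledDist X}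
    (hq : firstWeak γ l q = none) {h : Hypothesis X} (hh : h ∈ l) : ¬ loss q h ≤ 1 / 2 - γ := by
  simpa using List.find?_eq_none.1 hq h hh

lemma firstWeak_cons (γ : ℝ) (h : Hypothesis X) (l : List (Hypothesis X)) (q : LabeledDist X) :
    firstWeak γ (h :: l) q = if loss q h ≤ 1 / 2 - γ then some h else firstWeak γ l q := by
  unfold firstWeak
  rw [List.find?_cons]
  split_ifs with hq <;> simp only [hq, decide_true, decide_false]

lemma firstWeak_append_of_exists {γ : ℝ} {l l' : List (Hypothesis X)} {q : LabeledDist X}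
    (h : ∃ h ∈ l, loss q h ≤ 1 / 2 - γ) : firstWeak γ (l ++ l') q = firstWeak γ l q := by
  unfold firstWeak
  rw [List.find?_append, Option.or_of_isSome]
  rw [List.find?_isSome]
  simpa using h

/-- The uniform distribution on `X`, labelled by `c`. -/
noncomputable def uniformDist [Nonempty X] (c : X → Bool) : LabeledDist X :=
  ⟨fun z => if z.2 = c z.1 then (Fintype.card X : ℝ)⁻¹ else 0,
    fun z => by dsimp only; split_ifs <;> positivity, by
      rw [Fintype.sum_prod_type]
      simp⟩

lemma loss_uniformDist [Nonempty X] (c : X → Bool) (h : Hypothesis X) :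
    loss (uniformDist c) h = ∑ x, (Fintype.card X : ℝ)⁻¹ * if h x ≠ c x then 1 else 0 := by
  unfold loss uniformDist
  rw [Fintype.sum_prod_type]
  refine sum_congr rfl fun x _ => ?_
  cases hc : c x <;> cases hh : h x <;> simp [hc, hh]

variable {Ω : Type*} [MeasurableSpace Ω] {m p t : ℕ}

/-- The transcript of the first rounds if the oracle answers the queries of each round with the
blocks of the rounds up to that one. -/
noncomputable def blockTranscript (A : BoostingAlgorithm Ω X m p t) (γ : ℝ)
    (B : Fin p → J → Hypothesis X) (S : Fin m → X × Bool) (ω : Ω) :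
    ℕ → List (Fin t → Option (Hypothesis X))
  | 0 => []
  | n + 1 => blockTranscript A γ B S ω n ++
      [fun j => firstWeak γ (firstBlocks B (n + 1)) (A.query S (blockTranscript A γ B S ω n) j ω)]

/-- Causality of the simulation: it makes block `k` independent of the queries of round `k`, rounds
being counted from 0. -/
lemma blockTranscript_congr (A : BoostingAlgorithm Ω X m p t) (γ : ℝ)
    {B B' : Fin p → J → Hypothesis X} (S : Fin m → X × Bool) (ω : Ω) {n : ℕ}
    (h : ∀ k : Fin p, k.1 < n → B k = B' k) :
    blockTranscript A γ B S ω n = blockTranscript A γ B' S ω n := by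
  induction n with
  | zero => rfl
  | succ n ih =>
    simp only [blockTranscript]
    rw [ih fun k hk => h k (by omega), firstBlocks_congr h]

/-- Some query of round `k` is not answered by the `k`-th block. -/
def BlockFails (A : BoostingAlgorithm Ω X m p t) (γ : ℝ)
    (B : Fin p → J → Hypothesis X) (S : Fin m → X × Bool) (ω : Ω) (k : Fin p) : Prop :=
  ∃ i : Fin t, ∀ j, ¬ loss (A.query S (blockTranscript A γ B S ω k) i ω) (B k j) ≤ 1 / 2 - γ

/-- Each query finds a weak hypothesis no later than in the block of its own round, so neither later
blocks nor `l` are consulted. Hence `l` may reveal `c`. -/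
lemma transcript_eq_blockTranscript (A : BoostingAlgorithm Ω X m p t) (γ : ℝ)
    (B : Fin p → J → Hypothesis X) (l : List (Hypothesis X)) (S : Fin m → X × Bool) (ω : Ω)
    (hB : ∀ k, ¬ BlockFails A γ B S ω k) {n : ℕ} (hn : n ≤ p) :
    A.transcript (firstWeak γ (firstBlocks B p ++ l)) S ω n = blockTranscript A γ B S ω n := by
  induction n with
  | zero => rfl
  | succ n ih =>
    have hk := hB ⟨n, hn⟩
    unfold BlockFails at hk
    push Not at hk
    simp only [blockTranscript, BoostingAlgorithm.transcript, ih (by omega)]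
    congr 2
    funext i
    obtain ⟨j, hj⟩ := hk i
    obtain ⟨l', hl'⟩ := firstBlocks_prefix B hn
    rw [hl', List.append_assoc]
    exact firstWeak_append_of_exists ⟨_, mem_firstBlocks_succ B ⟨n, hn⟩ j, hj⟩

variable [DecidableEq X] [DecidableEq J]

open Classical in
/-- The probability that a block fails in its round. -/
lemma sum_blocksLaw_blockFails_le (A : BoostingAlgorithm Ω X m p t) {γ δ : ℝ} {θ : J → ℝ}
    (h0 : ∀ j, 0 ≤ θ j) (h1 : ∀ j, θ j ≤ 1) {c : X → Bool} (S : Fin m → X × Bool) (ω : Ω)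
    (hS : ∀ i, (S i).2 = c (S i).1)
    (hδ : ∀ q : LabeledDist X, (∀ z, q.1 z ≠ 0 → z.2 = c z.1) →
      ∑ b with ∀ j, ¬ loss q (b j) ≤ 1 / 2 - γ, blockLaw θ c b ≤ δ) (k : Fin p) :
    ∑ B, blocksLaw θ c B * (if BlockFails A γ B S ω k then 1 else 0) ≤ t * δ := by
  -- Redraw block `k`: the queries of its round do not change, so `hδ` applies to each of them for
  -- the fresh block.
  rw [sum_blocksLaw_mul_eq_sum_update θ c k]
  have hin : ∀ B : Fin p → J → X → Bool, ∑ b, blockLaw θ c b *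
      (if BlockFails A γ (Function.update B k b) S ω k then 1 else 0) ≤ t * δ := by
    intro B
    set Q : Fin t → LabeledDist X := fun i => A.query S (blockTranscript A γ B S ω k) i ω with hQ
    have hf : ∀ b, BlockFails A γ (Function.update B k b) S ω k ↔
        ∃ i, ∀ j, ¬ loss (Q i) (b j) ≤ 1 / 2 - γ := by
      intro b
      have : blockTranscript A γ (Function.update B k b) S ω k = blockTranscript A γ B S ω k :=
        blockTranscript_congr A γ S ω fun k' hk' =>
          Function.update_of_ne (fun h => by simp [h] at hk') _ _
      simp only [BlockFails, this, Function.update_self, hQ]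
    calc ∑ b, blockLaw θ c b *
          (if BlockFails A γ (Function.update B k b) S ω k then 1 else 0)
        ≤ ∑ b, ∑ i : Fin t, if ∀ j, ¬ loss (Q i) (b j) ≤ 1 / 2 - γ then blockLaw θ c b else 0 := by
          refine sum_le_sum fun b _ => ?_
          have hnn : ∀ i : Fin t, 0 ≤
              if ∀ j, ¬ loss (Q i) (b j) ≤ 1 / 2 - γ then blockLaw θ c b else 0 := fun i => by
            split_ifs; exacts [blockLaw_nonneg h0 h1 c b, le_rfl]
          by_cases hb : BlockFails A γ (Function.update B k b) S ω k
          · rw [if_pos hb, mul_one]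
            obtain ⟨i, hi⟩ := (hf b).1 hb
            refine le_trans ?_ (single_le_sum (fun i _ => hnn i) (mem_univ i))
            rw [if_pos hi]
          · rw [if_neg hb, mul_zero]
            exact sum_nonneg fun i _ => hnn i
      _ = ∑ i : Fin t, ∑ b with ∀ j, ¬ loss (Q i) (b j) ≤ 1 / 2 - γ, blockLaw θ c b := by
          rw [sum_comm]
          exact sum_congr rfl fun i _ => (sum_filter _ _).symm
      _ ≤ ∑ _i : Fin t, δ := by
          refine sum_le_sum fun i _ => hδ _ fun z hz => ?_
          obtain ⟨k, rfl⟩ := A.query_support _ _ _ _ z hz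
          exact hS k
      _ = t * δ := by simp
  calc _ ≤ ∑ B : Fin p → J → X → Bool, blocksLaw θ c B * (t * δ) :=
        sum_le_sum fun B _ => mul_le_mul_of_nonneg_left (hin B) (blocksLaw_nonneg h0 h1 c B)
    _ = t * δ := by rw [← sum_mul, sum_blocksLaw, one_mul]

/-- The average loss over the labellings and the blocks, for fixed sample points and fixed internal
randomness. -/
lemma le_sum_blocksLaw_loss [Nonempty X] (A : BoostingAlgorithm Ω X m p t)
    (hm : Fintype.card X = 2 * m) {γ δ : ℝ}
    {θ : J → ℝ} (h0 : ∀ j, 0 ≤ θ j) (h1 : ∀ j, θ j ≤ 1)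
    (hδ : ∀ (c : X → Bool) (q : LabeledDist X), (∀ z, q.1 z ≠ 0 → z.2 = c z.1) →
      ∑ b with ∀ j, ¬ loss q (b j) ≤ 1 / 2 - γ, blockLaw θ c b ≤ δ)
    (hptδ : p * (t * δ) ≤ 1 / 32) (hθ : 1 / 2 ≤ (∏ j, (1 - θ j ^ 2)) ^ p)
    (l : (X → Bool) → (Fin p → J → X → Bool) → List (Hypothesis X)) (s : Fin m → X) (ω : Ω) :
    2 ^ Fintype.card X * (1 / 32) ≤ ∑ c : X → Bool, ∑ B, blocksLaw θ c B *
      loss (uniformDist c)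
        (A.run (firstWeak γ (firstBlocks B p ++ l c B)) (fun i => (s i, c (s i))) ω) := by
  classical
  set out : (X → Bool) → (Fin p → J → X → Bool) → X → Bool := fun c B =>
    A.output (fun i => (s i, c (s i))) (blockTranscript A γ B (fun i => (s i, c (s i))) ω p) ω
    with hout
  set F : (X → Bool) → (Fin p → J → X → Bool) → Fin p → ℝ := fun c B k =>
    if BlockFails A γ B (fun i => (s i, c (s i))) ω k then 1 else 0 with hF
  have hF0 : ∀ c B k, 0 ≤ F c B k := fun c B k => by simp only [hF]; split_ifs <;> norm_num
  -- Each failing block is charged 1, the largest possible loss.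
  have hpt : ∀ c B, loss (uniformDist c) (out c B) - ∑ k, F c B k ≤ loss (uniformDist c)
      (A.run (firstWeak γ (firstBlocks B p ++ l c B)) (fun i => (s i, c (s i))) ω) := by
    intro c B
    by_cases hB : ∀ k, ¬ BlockFails A γ B (fun i => (s i, c (s i))) ω k
    · rw [BoostingAlgorithm.run, transcript_eq_blockTranscript A γ B _ _ ω hB le_rfl]
      linarith [sum_nonneg fun k (_ : k ∈ univ) => hF0 c B k]
    · push Not at hB
      obtain ⟨k, hk⟩ := hB
      have h2 : 1 ≤ ∑ k, F c B k := by
        refine le_trans ?_ (single_le_sum (fun k _ => hF0 c B k) (mem_univ k))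
        simp [hF, hk]
      linarith [loss_le_one (uniformDist c) (out c B), loss_nonneg (uniformDist c)
        (A.run (firstWeak γ (firstBlocks B p ++ l c B)) (fun i => (s i, c (s i))) ω)]
  have hfail : ∀ c, ∑ B, blocksLaw θ c B * ∑ k, F c B k ≤ 1 / 32 := by
    intro c
    simp_rw [mul_sum]
    rw [sum_comm]
    refine (sum_le_sum fun k _ => sum_blocksLaw_blockFails_le A h0 h1 _ ω (fun i => rfl)
      (hδ c) k).trans ?_
    simpa using hptδ
  have hsim : 2 ^ Fintype.card X * (1 / 16) ≤
      ∑ c : X → Bool, ∑ B, blocksLaw θ c B * loss (uniformDist c) (out c B) := by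
    have hswap : ∑ c : X → Bool, ∑ B, blocksLaw θ c B * loss (uniformDist c) (out c B) =
        ∑ x, (Fintype.card X : ℝ)⁻¹ *
          ∑ c : X → Bool, ∑ B, blocksLaw θ c B * if out c B x ≠ c x then 1 else 0 := by
      simp_rw [loss_uniformDist, mul_sum]
      rw [sum_comm' (t' := univ) (s' := fun _ => univ) (by simp)]
      rw [sum_comm]
      conv_rhs => rw [sum_comm]
      refine sum_congr rfl fun c _ => ?_
      conv_rhs => rw [sum_comm]
      exact sum_congr rfl fun B _ => sum_congr rfl fun x _ => by ring
    rw [hswap]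
    -- Flipping the label of an unseen point changes neither the sample nor the simulated output, so
    -- the two-point bound gives error 1/8 there. At least half of the points are unseen.
    set U : Finset X := univ \ univ.image s with hU
    have hUcard : m ≤ U.card := by
      rw [hU, card_sdiff_of_subset (subset_univ _), card_univ, hm]
      have : (univ.image s).card ≤ m := card_image_le.trans (by simp)
      omega
    have hx : ∀ x ∈ U, 2 ^ Fintype.card X * (1 / 8) ≤
        ∑ c : X → Bool, ∑ B, blocksLaw θ c B * if out c B x ≠ c x then 1 else 0 := by
      intro x hx
      refine le_trans ?_ (le_sum_blocksLaw_ne h0 h1 x (fun c B => out c B x) ?_)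
      · exact mul_le_mul_of_nonneg_left (by linarith) (by positivity)
      · intro c B
        have : ∀ i, flipAt x c (s i) = c (s i) := fun i => by
          refine Function.update_of_ne ?_ _ _
          rintro rfl
          simp [hU] at hx
        simp only [hout, this]
    have hcard : (Fintype.card X : ℝ) = 2 * m := by exact_mod_cast hm
    have hpos : 0 < (Fintype.card X : ℝ) := by exact_mod_cast Fintype.card_pos
    calc (2 : ℝ) ^ Fintype.card X * (1 / 16)
        ≤ ∑ x ∈ U, (Fintype.card X : ℝ)⁻¹ * (2 ^ Fintype.card X * (1 / 8)) := by
          rw [sum_const, nsmul_eq_mul]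
          have : (1 : ℝ) / 2 ≤ U.card * (Fintype.card X : ℝ)⁻¹ := by
            rw [← div_eq_mul_inv, div_le_div_iff₀ two_pos hpos, hcard]
            have : (m : ℝ) ≤ U.card := by exact_mod_cast hUcard
            linarith
          have h2 : (0 : ℝ) < 2 ^ Fintype.card X := by positivity
          nlinarith
      _ ≤ ∑ x ∈ U, (Fintype.card X : ℝ)⁻¹ *
          ∑ c : X → Bool, ∑ B, blocksLaw θ c B * if out c B x ≠ c x then 1 else 0 :=
          sum_le_sum fun x hxU => mul_le_mul_of_nonneg_left (hx x hxU) (by positivity)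
      _ ≤ _ := by
          refine sum_le_univ_sum_of_nonneg fun x => mul_nonneg (by positivity) ?_
          exact sum_nonneg fun c _ => sum_nonneg fun B _ =>
            mul_nonneg (blocksLaw_nonneg h0 h1 c B) (by split_ifs <;> norm_num)
  have hdiff : ∑ c : X → Bool, (∑ B, blocksLaw θ c B * loss (uniformDist c) (out c B) - 1 / 32) ≤
      ∑ c : X → Bool, ∑ B, blocksLaw θ c B * loss (uniformDist c)
        (A.run (firstWeak γ (firstBlocks B p ++ l c B)) (fun i => (s i, c (s i))) ω) := by
    refine sum_le_sum fun c _ => ?_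
    have h2 := sum_le_sum fun B (_ : B ∈ univ) =>
      mul_le_mul_of_nonneg_left (hpt c B) (blocksLaw_nonneg h0 h1 c B)
    simp_rw [mul_sub] at h2
    rw [sum_sub_distrib] at h2
    linarith [hfail c]
  rw [sum_sub_distrib, sum_const, card_univ, nsmul_eq_mul] at hdiff
  simp only [Fintype.card_pi, Fintype.card_bool, prod_const, card_univ] at hdiff
  push_cast at hdiff
  linarith

end

/-! ### Measurability in the internal randomness, and averaging. -/

section

variable {X : Type*} [Fintype X]

lemma measurable_loss (h : Hypothesis X) : Measurable fun q : LabeledDist X => loss q h := by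
  unfold loss
  refine Finset.measurable_sum _ fun z _ => ?_
  split_ifs
  · exact (measurable_pi_apply z).comp measurable_subtype_coe
  · exact measurable_const

lemma measurableSet_firstWeak_preimage (γ : ℝ) (l : List (Hypothesis X))
    (a : Option (Hypothesis X)) : MeasurableSet (firstWeak γ l ⁻¹' {a}) := by
  induction l with
  | nil => exact MeasurableSet.const (none = a)
  | cons h l ih =>
    have hE : MeasurableSet {q : LabeledDist X | loss q h ≤ 1 / 2 - γ} :=
      measurableSet_le (measurable_loss h) measurable_const
    have : firstWeak γ (h :: l) ⁻¹' {a} =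
        ({q : LabeledDist X | loss q h ≤ 1 / 2 - γ} ∩ {_q | some h = a}) ∪
          ({q : LabeledDist X | loss q h ≤ 1 / 2 - γ}ᶜ ∩ firstWeak γ l ⁻¹' {a}) := by
      ext q
      simp only [Set.mem_preimage, Set.mem_singleton_iff, firstWeak_cons, Set.mem_union,
        Set.mem_inter_iff, Set.mem_ofPred_eq, Set.mem_compl_iff]
      by_cases hq : loss q h ≤ 1 / 2 - γ <;> simp only [hq, if_true, if_false] <;> tauto
    rw [this]
    exact (hE.inter (MeasurableSet.const _)).union (hE.compl.inter ih)

variable {Ω : Type*} [MeasurableSpace Ω] {m p t : ℕ}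

/-- As `X` is finite, there are countably many transcripts, and the event splits over those of the
preceding rounds. -/
lemma measurableSet_transcript_eq (A : BoostingAlgorithm Ω X m p t) {W : Oracle X}
    (hW : ∀ a, MeasurableSet (W ⁻¹' {a})) (S : Fin m → X × Bool) (n : ℕ)
    (L : List (Fin t → Option (Hypothesis X))) :
    MeasurableSet {ω | A.transcript W S ω n = L} := by
  induction n generalizing L with
  | zero => exact MeasurableSet.const ([] = L)
  | succ n ih =>
    have : {ω | A.transcript W S ω (n + 1) = L} =
        ⋃ L', {ω | A.transcript W S ω n = L'} ∩
          {ω | L' ++ [fun j => W (A.query S L' j ω)] = L} := by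
      ext ω; simp [BoostingAlgorithm.transcript]
    rw [this]
    refine MeasurableSet.iUnion fun L' => (ih L').inter ?_
    by_cases hL : ∃ a, L = L' ++ [a]
    · obtain ⟨a, rfl⟩ := hL
      have : {ω | L' ++ [fun j => W (A.query S L' j ω)] = L' ++ [a]} =
          ⋂ j, A.query S L' j ⁻¹' (W ⁻¹' {a j}) := by
        ext ω; simp [funext_iff]
      rw [this]
      exact MeasurableSet.iInter fun j => A.measurable_query S L' j (hW _)
    · convert MeasurableSet.empty
      rw [Set.eq_empty_iff_forall_notMem]
      exact fun ω hω => hL ⟨_, hω.symm⟩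

lemma measurable_run (A : BoostingAlgorithm Ω X m p t) {W : Oracle X}
    (hW : ∀ a, MeasurableSet (W ⁻¹' {a})) (S : Fin m → X × Bool) :
    Measurable (A.run W S) := by
  intro E hE
  have : A.run W S ⁻¹' E =
      ⋃ L, {ω | A.transcript W S ω p = L} ∩ A.output S L ⁻¹' E := by
    ext ω; simp [BoostingAlgorithm.run]
  rw [this]
  exact MeasurableSet.iUnion fun L =>
    (measurableSet_transcript_eq A hW S p L).inter (A.measurable_output S L hE)

lemma integrable_loss_run (A : BoostingAlgorithm Ω X m p t) (μ : Measure Ω)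
    [IsProbabilityMeasure μ] (D : LabeledDist X) {W : Oracle X}
    (hW : ∀ a, MeasurableSet (W ⁻¹' {a})) (S : Fin m → X × Bool) :
    Integrable (fun ω => loss D (A.run W S ω)) μ := by
  refine Integrable.of_bound (C := 1) ?_ (Filter.Eventually.of_forall fun ω => ?_)
  · exact ((Measurable.of_discrete (f := loss D)).comp (measurable_run A hW S)).aestronglyMeasurable
  · rw [Real.norm_eq_abs, abs_of_nonneg (loss_nonneg _ _)]
    exact loss_le_one _ _

/-- Samples labelled by `c` are determined by their points; the terms of all other samples are
nonnegative and are dropped. -/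
lemma le_expectedLoss_uniformDist [Nonempty X] (A : BoostingAlgorithm Ω X m p t) (μ : Measure Ω)
    (c : X → Bool) (W : Oracle X) :
    ∑ s : Fin m → X, (Fintype.card X : ℝ)⁻¹ ^ m *
      ∫ ω, loss (uniformDist c) (A.run W (fun i => (s i, c (s i))) ω) ∂μ ≤
      A.expectedLoss μ (uniformDist c) W := by
  classical
  have hinj : Function.Injective fun (s : Fin m → X) i => (s i, c (s i)) := fun s s' h =>
    funext fun i => congrArg Prod.fst (congrFun h i)
  have hnn : ∀ S : Fin m → X × Bool, 0 ≤ (∏ k, (uniformDist c).1 (S k)) *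
      ∫ ω, loss (uniformDist c) (A.run W S ω) ∂μ := fun S =>
    mul_nonneg (prod_nonneg fun k _ => (uniformDist c).2.1 _)
      (integral_nonneg fun ω => loss_nonneg _ _)
  unfold BoostingAlgorithm.expectedLoss
  refine le_trans (le_of_eq ?_) (sum_le_univ_sum_of_nonneg (s := univ.map ⟨_, hinj⟩) hnn)
  rw [sum_map]
  refine sum_congr rfl fun s _ => ?_
  simp [uniformDist]

/-- The lower bound in terms of a law of the blocks that has little information on the labels and
answers each query with high probability. -/
theorem exists_class_le_expectedLoss {J : Type*} [Fintype J] [DecidableEq X]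
    [DecidableEq J] [Nonempty X]
    (A : BoostingAlgorithm Ω X m p t) (μ : Measure Ω) [IsProbabilityMeasure μ]
    (hm : Fintype.card X = 2 * m) {γ δ : ℝ}
    {θ : J → ℝ} (h0 : ∀ j, 0 ≤ θ j) (h1 : ∀ j, θ j ≤ 1)
    (hδ : ∀ (c : X → Bool) (q : LabeledDist X), (∀ z, q.1 z ≠ 0 → z.2 = c z.1) →
      ∑ b with ∀ j, ¬ loss q (b j) ≤ 1 / 2 - γ, blockLaw θ c b ≤ δ)
    (hptδ : p * (t * δ) ≤ 1 / 32) (hθ : 1 / 2 ≤ (∏ j, (1 - θ j ^ 2)) ^ p)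
    {k : ℕ} (hk : k ≤ Fintype.card X)
    (hcard : k = Fintype.card X ∨ 1 + p * Fintype.card J < 2 ^ (k + 1)) :
    ∃ (H : Set (Hypothesis X)) (D : LabeledDist X) (W : Oracle X),
      HasVCDim H k ∧ Realizable H D ∧ IsWeakLearner γ H W ∧ 1 / 32 ≤ A.expectedLoss μ D W := by
  have hext : ∀ (c : X → Bool) (B : Fin p → J → X → Bool), ∃ H : Set (Hypothesis X),
      insert c (Set.range fun z : Fin p × J => B z.1 z.2) ⊆ H ∧ HasVCDim H k := by
    intro c B
    refine exists_superset_hasVCDim hk fun S hS => ?_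
    rcases hcard with rfl | hcard
    · exact card_le_univ S
    by_contra! hlt
    have hn : (insert c (Set.range fun z : Fin p × J => B z.1 z.2)).ncard
        ≤ p * Fintype.card J + 1 := by
      refine (Set.ncard_insert_le _ _).trans (Nat.add_le_add_right ?_ 1)
      rw [← Set.image_univ]
      refine (Set.ncard_image_le).trans ?_
      simp [Set.ncard_univ]
    have h2 : 2 ^ (k + 1) ≤ 2 ^ S.card := Nat.pow_le_pow_right two_pos hlt
    have := hS.two_pow_card_le
    omega
  choose H hsub hvc using hext
  -- Listing the whole class after the blocks makes the oracle complete.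
  set l : (X → Bool) → (Fin p → J → X → Bool) → List (Hypothesis X) := fun c B =>
    (Set.toFinite (H c B)).toFinset.toList with hl
  have hmeml : ∀ c B h, h ∈ l c B ↔ h ∈ H c B := fun c B h => by simp [hl]
  set W : (X → Bool) → (Fin p → J → X → Bool) → Oracle X := fun c B =>
    firstWeak γ (firstBlocks B p ++ l c B) with hW
  have hWmeas : ∀ c B a, MeasurableSet (W c B ⁻¹' {a}) := fun c B a =>
    measurableSet_firstWeak_preimage _ _ _
  set e : (X → Bool) × (Fin p → J → X → Bool) → ℝ := fun z =>
    A.expectedLoss μ (uniformDist z.1) (W z.1 z.2) with he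
  have havg : 2 ^ Fintype.card X * (1 / 32) ≤ ∑ c, ∑ B, blocksLaw θ c B * e (c, B) := by
    have hcardX : (Fintype.card X : ℝ) ≠ 0 := by exact_mod_cast Fintype.card_ne_zero
    calc (2 : ℝ) ^ Fintype.card X * (1 / 32)
        = ∑ _s : Fin m → X, (Fintype.card X : ℝ)⁻¹ ^ m *
            ∫ _ω, (2 : ℝ) ^ Fintype.card X * (1 / 32) ∂μ := by
          simp only [sum_const, card_univ, Fintype.card_pi, prod_const, nsmul_eq_mul,
            integral_const, probReal_univ, smul_eq_mul, one_mul, Fintype.card_fin]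
          rw [← mul_assoc, Nat.cast_pow, ← mul_pow, mul_inv_cancel₀ hcardX, one_pow, one_mul]
      _ ≤ ∑ s : Fin m → X, (Fintype.card X : ℝ)⁻¹ ^ m *
            ∫ ω, ∑ c, ∑ B, blocksLaw θ c B *
              loss (uniformDist c) (A.run (W c B) (fun i => (s i, c (s i))) ω) ∂μ := by
          refine sum_le_sum fun s _ => mul_le_mul_of_nonneg_left ?_ (by positivity)
          refine integral_mono (integrable_const _) ?_ fun ω =>
            le_sum_blocksLaw_loss A hm h0 h1 hδ hptδ hθ l s ω
          exact integrable_finsetSum _ fun c _ => integrable_finsetSum _ fun B _ =>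
            (integrable_loss_run A μ _ (hWmeas c B) _).const_mul _
      _ = ∑ c, ∑ B, blocksLaw θ c B * ∑ s : Fin m → X, (Fintype.card X : ℝ)⁻¹ ^ m *
            ∫ ω, loss (uniformDist c) (A.run (W c B) (fun i => (s i, c (s i))) ω) ∂μ := by
          have hint : ∀ c B (s : Fin m → X), Integrable (fun ω => blocksLaw θ c B *
              loss (uniformDist c) (A.run (W c B) (fun i => (s i, c (s i))) ω)) μ := fun c B s =>
            (integrable_loss_run A μ _ (hWmeas c B) _).const_mul _
          have hpush : ∀ s : Fin m → X, ∫ ω, ∑ c, ∑ B, blocksLaw θ c B *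
              loss (uniformDist c) (A.run (W c B) (fun i => (s i, c (s i))) ω) ∂μ =
              ∑ c, ∑ B, blocksLaw θ c B *
                ∫ ω, loss (uniformDist c) (A.run (W c B) (fun i => (s i, c (s i))) ω) ∂μ := by
            intro s
            rw [integral_finsetSum _ fun c _ => integrable_finsetSum _ fun B _ => hint c B s]
            refine sum_congr rfl fun c _ => ?_
            rw [integral_finsetSum _ fun B _ => hint c B s]
            exact sum_congr rfl fun B _ => integral_const_mul _ _
          simp_rw [hpush, mul_sum]
          rw [sum_comm]
          refine sum_congr rfl fun c _ => ?_
          rw [sum_comm]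
          exact sum_congr rfl fun B _ => sum_congr rfl fun s _ => by ring
      _ ≤ _ := sum_le_sum fun c _ => sum_le_sum fun B _ =>
          mul_le_mul_of_nonneg_left (le_expectedLoss_uniformDist A μ c (W c B))
            (blocksLaw_nonneg h0 h1 c B)
  -- The block weights sum to 1 for each labelling, so the maximum is at least the average 1/32.
  obtain ⟨⟨c, B⟩, hmax⟩ := Finite.exists_max e
  refine ⟨H c B, uniformDist c, W c B, hvc c B, ⟨c, hsub c B (Set.mem_insert _ _), ?_⟩,
    ⟨fun q h hh => ?_, fun q hq h hh => ?_⟩, ?_⟩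
  · simp [loss_uniformDist]
  · obtain ⟨hmem, hloss⟩ := firstWeak_sound hh
    refine ⟨?_, hloss⟩
    rcases List.mem_append.1 hmem with hmem | hmem
    · obtain ⟨k, j, rfl⟩ := firstBlocks_subset hmem
      exact hsub c B (Set.mem_insert_of_mem _ ⟨(k, j), rfl⟩)
    · exact (hmeml c B h).1 hmem
  · exact firstWeak_complete hq (List.mem_append_right _ ((hmeml c B h).2 hh))
  · have hle : ∑ c', ∑ B', blocksLaw θ c' B' * e (c', B') ≤
        ∑ c' : X → Bool, ∑ B' : Fin p → J → X → Bool, blocksLaw θ c' B' * e (c, B) :=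
      sum_le_sum fun c' _ => sum_le_sum fun B' _ =>
        mul_le_mul_of_nonneg_left (hmax (c', B')) (blocksLaw_nonneg h0 h1 c' B')
    have h2 := havg.trans hle
    simp_rw [← sum_mul, sum_blocksLaw] at h2
    simp only [sum_const, card_univ, Fintype.card_pi, prod_const, Fintype.card_bool, nsmul_eq_mul,
      mul_one] at h2
    push_cast at h2
    exact le_of_mul_le_mul_left h2 (by positivity)

end

/-! ### A mixed block answers every query. -/

section

variable {X : Type*} [Fintype X]

lemma loss_eq_corr {c : X → Bool} {q : LabeledDist X} (hq : ∀ z, q.1 z ≠ 0 → z.2 = c z.1)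
    (h : Hypothesis X) : loss q h = 1 / 2 - corr (fun x => q.1 (x, c x)) c h / 2 := by
  have hz : ∀ x, q.1 (x, !c x) = 0 := fun x => by
    by_contra hne
    simpa using hq _ hne
  have hsum : ∀ f : X × Bool → ℝ, ∑ z, f z = ∑ x, (f (x, c x) + f (x, !c x)) := fun f => by
    rw [Fintype.sum_prod_type]
    refine sum_congr rfl fun x _ => ?_
    cases c x <;> simp [add_comm]
  have h1 : ∑ x, q.1 (x, c x) = 1 := by
    have := q.2.2
    rw [hsum] at this
    simpa [hz] using this
  have h2 : loss q h = ∑ x, (q.1 (x, c x) / 2 - q.1 (x, c x) * agree (c x) (h x) / 2) := by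
    unfold loss
    rw [hsum]
    refine sum_congr rfl fun x _ => ?_
    rw [hz]
    by_cases hx : h x = c x
    · simp [hx, agree]
    · simp [hx, agree, Ne.symm hx]
      ring
  rw [h2, sum_sub_distrib, ← sum_div, ← sum_div, h1, corr]

lemma sum_labelWeight {c : X → Bool} {q : LabeledDist X} (hq : ∀ z, q.1 z ≠ 0 → z.2 = c z.1) :
    ∑ x, q.1 (x, c x) = 1 := by
  rw [← q.2.2, Fintype.sum_prod_type]
  refine sum_congr rfl fun x _ => ?_
  have hz : q.1 (x, !c x) = 0 := by
    by_contra hne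
    simpa using hq _ hne
  cases hc : c x <;> simp_all

variable [DecidableEq X]

/-- A block of `r` biased and `n` uniformly random hypotheses contains, with high probability, a
weak hypothesis for a given query. -/
lemma sum_blockLaw_fails_le {γ R : ℝ} {d r n : ℕ} (hd : 1 ≤ d) (hγ : 0 < γ) (hγ1 : γ ≤ 1 / 12)
    (hr : R ≤ r) (hn : R * (5 * d * Real.exp (650 * d)) ≤ n)
    (c : X → Bool) (q : LabeledDist X) (hq : ∀ z, q.1 z ≠ 0 → z.2 = c z.1) :
    ∑ b : Fin r ⊕ Fin n → X → Bool with ∀ j, ¬ loss q (b j) ≤ 1 / 2 - γ,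
      blockLaw (Sum.elim (fun _ => 6 * γ) fun _ => 0) c b ≤ Real.exp (-(5 * d * R)) := by
  set w : X → ℝ := fun x => q.1 (x, c x) with hw
  set a := ∑ h with corr w c h < 2 * γ, biasLaw (fun _ => 6 * γ) c h with ha
  set a' := ∑ h with corr w c h < 2 * γ, biasLaw (fun _ => 0) c h with ha'
  have hfail : ∀ h, ¬ loss q h ≤ 1 / 2 - γ ↔ corr w c h < 2 * γ := fun h => by
    rw [loss_eq_corr hq, not_le]; constructor <;> intro _ <;> linarith
  have key : ∑ b : Fin r ⊕ Fin n → X → Bool with ∀ j, ¬ loss q (b j) ≤ 1 / 2 - γ,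
      blockLaw (Sum.elim (fun _ => 6 * γ) fun _ => 0) c b = a ^ r * a' ^ n := by
    have e : ∀ b : Fin r ⊕ Fin n → X → Bool, (if ∀ j, ¬ loss q (b j) ≤ 1 / 2 - γ then
        blockLaw (Sum.elim (fun _ => 6 * γ) fun _ => 0) c b else 0) =
        ∏ j, if corr w c (b j) < 2 * γ then
          biasLaw (fun _ => Sum.elim (fun _ => 6 * γ) (fun _ => 0) j) c (b j) else 0 := by
      intro b
      simp_rw [hfail]
      rw [prod_ite_zero]
      simp [blockLaw]
    rw [sum_filter]
    simp_rw [e]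
    rw [← Fintype.prod_sum (fun (j : Fin r ⊕ Fin n) h => if corr w c h < 2 * γ then
          biasLaw (fun _ => Sum.elim (fun _ => 6 * γ) (fun _ => 0) j) c h else 0),
      Fintype.prod_sum_type]
    simp [ha, ha', sum_filter]
  rw [key]
  have htot : ∀ θ : ℝ, 0 ≤ θ → θ ≤ 1 → 0 ≤ ∑ h with corr w c h < 2 * γ, biasLaw (fun _ => θ) c h ∧
      ∑ h with corr w c h < 2 * γ, biasLaw (fun _ => θ) c h ≤ 1 := fun θ h0 h1 =>
    ⟨sum_nonneg fun h _ => biasLaw_nonneg (fun _ => h0) (fun _ => h1) c h, by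
      rw [← sum_biasLaw (fun _ => θ) c]
      exact sum_le_univ_sum_of_nonneg fun h => biasLaw_nonneg (fun _ => h0) (fun _ => h1) c h⟩
  obtain ⟨ha0, ha1⟩ := htot (6 * γ) (by positivity) (by linarith)
  obtain ⟨ha'0, ha'1⟩ := htot 0 le_rfl zero_le_one
  rw [← ha] at ha0 ha1
  rw [← ha'] at ha'0 ha'1
  -- In the first case the uniform members alone give `exp (-n * exp (-650d))`, and `n` is large
  -- enough for this; in the second the `r ≥ R` biased members alone suffice.
  rcases uniform_or_biased (w := w) (fun x => q.2.1 _) (sum_labelWeight hq) c hd hγ hγ1 with h | h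
  · have hsplit := sum_filter_add_sum_filter_not univ (fun h => corr w c h < 2 * γ)
      (biasLaw (fun _ => 0) c)
    rw [sum_biasLaw] at hsplit
    simp only [not_lt] at hsplit
    have h' : Real.exp (-(650 * (d : ℝ))) ≤
      ∑ h with 2 * γ ≤ corr w c h, biasLaw (fun _ => 0) c h := h
    have hle : a' ≤ Real.exp (-Real.exp (-(650 * (d : ℝ)))) := by
      have := Real.add_one_le_exp (-Real.exp (-(650 * (d : ℝ))))
      linarith
    calc a ^ r * a' ^ n ≤ 1 * Real.exp (-Real.exp (-(650 * (d : ℝ)))) ^ n :=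
          mul_le_mul (pow_le_one₀ ha0 ha1) (pow_le_pow_left₀ ha'0 hle n) (pow_nonneg ha'0 n)
            zero_le_one
      _ = Real.exp (-(n * Real.exp (-(650 * (d : ℝ))))) := by
          rw [one_mul, ← Real.exp_nat_mul]; ring_nf
      _ ≤ _ := by
          refine Real.exp_le_exp.2 (neg_le_neg ?_)
          have := mul_le_mul_of_nonneg_right hn (Real.exp_pos (-(650 * (d : ℝ)))).le
          refine le_trans (le_of_eq ?_) this
          have e : Real.exp (650 * d) * Real.exp (-(650 * d)) = 1 := by
            rw [← Real.exp_add, add_neg_cancel, Real.exp_zero]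
          linear_combination -(5 * d * R) * e
  · calc a ^ r * a' ^ n ≤ Real.exp (-(5 * (d : ℝ))) ^ r * 1 :=
          mul_le_mul (pow_le_pow_left₀ ha0 h r) (pow_le_one₀ ha'0 ha'1) (pow_nonneg ha'0 n)
            (by positivity)
      _ = Real.exp (-(5 * d * r)) := by
          rw [mul_one, ← Real.exp_nat_mul]; ring_nf
      _ ≤ _ := by
          refine Real.exp_le_exp.2 (neg_le_neg ?_)
          exact mul_le_mul_of_nonneg_left hr (by positivity)

end

/-! ### Numerical estimates and choice of constants. -/

lemma exp_neg_four_le : Real.exp (-4) ≤ 1 / 32 := by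
  have h1 := Real.exp_one_gt_d9
  have e : Real.exp 4 = Real.exp 1 ^ 4 := by rw [← Real.exp_nat_mul]; norm_num
  have : (2.7 : ℝ) ^ 4 ≤ Real.exp 1 ^ 4 := pow_le_pow_left₀ (by norm_num) (by linarith) 4
  rw [Real.exp_neg, e, one_div]
  exact inv_anti₀ (by norm_num) (by norm_num at this ⊢; linarith)

/-- Both `p * R` and `d` are at most `exp d`, so the number of hypotheses is at most `1 + 8
exp(652d)`; with `e ≤ 4` this is at most `9 * 2 ^ (1304d)`. -/
lemma card_blocks_lt {R : ℝ} {d p r n : ℕ} (hd : 1 ≤ d) (hR : 1 ≤ R)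
    (hpR : p * R ≤ Real.exp (1 / 2000 * d)) (hr : (r : ℝ) ≤ R + 1)
    (hn : (n : ℝ) ≤ R * (5 * d * Real.exp (650 * d)) + 1) :
    1 + p * (r + n) < 2 ^ (2000 * d + 1) := by
  have hd' : (1 : ℝ) ≤ d := by exact_mod_cast hd
  have hE : (1 : ℝ) ≤ Real.exp (650 * d) := Real.one_le_exp (by positivity)
  have hdE : 1 ≤ d * Real.exp (650 * d) := one_le_mul_of_one_le_of_one_le hd' hE
  have hde : (d : ℝ) ≤ Real.exp d := by linarith [Real.add_one_le_exp (d : ℝ)]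
  have hpR' : p * R ≤ Real.exp d := hpR.trans (Real.exp_le_exp.2 (by linarith))
  have hp0 : (0 : ℝ) ≤ p := Nat.cast_nonneg p
  have h1 : (p : ℝ) * (r + n) ≤ p * R * (8 * (d * Real.exp (650 * d))) := by
    rw [mul_assoc]
    refine mul_le_mul_of_nonneg_left ?_ hp0
    nlinarith
  have h2 : p * R * (8 * (d * Real.exp (650 * d))) ≤
      Real.exp d * (8 * (Real.exp d * Real.exp (650 * d))) := by gcongr
  have h3 : Real.exp d * (8 * (Real.exp d * Real.exp (650 * d))) = 8 * Real.exp (652 * d) := by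
    rw [mul_left_comm, ← Real.exp_add, ← Real.exp_add]; ring_nf
  have h4 : Real.exp (652 * d) ≤ 2 ^ (1304 * d) := by
    have he : Real.exp 1 ≤ 2 ^ 2 := by linarith [Real.exp_one_lt_d9]
    have e : Real.exp (652 * d) = Real.exp 1 ^ (652 * d) := by
      rw [← Real.exp_nat_mul]; push_cast; ring_nf
    rw [e]
    refine (pow_le_pow_left₀ (Real.exp_pos _).le he _).trans (le_of_eq ?_)
    rw [← pow_mul]; ring_nf
  have h5 : (1 : ℝ) ≤ 2 ^ (1304 * d) := one_le_pow₀ (by norm_num)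
  have h6 : (1 : ℝ) + p * (r + n) < 2 ^ (2000 * d + 1) := by
    calc (1 : ℝ) + p * (r + n) ≤ 9 * 2 ^ (1304 * d) := by linarith
      _ < 2 ^ 4 * 2 ^ (1304 * d) := by
          refine mul_lt_mul_of_pos_right (by norm_num) (by positivity)
      _ = 2 ^ (4 + 1304 * d) := (pow_add _ _ _).symm
      _ ≤ 2 ^ (2000 * d + 1) := pow_le_pow_right₀ (by norm_num) (by omega)
  exact_mod_cast h6

end ParallelBoosting

theorem theorem4p7 :
    ∃ c : ℝ, 0 < c ∧ ∃ C : ℝ, 0 < C ∧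
      ∀ (R γ : ℝ) (d m p t : ℕ), 1 ≤ R → 0 < γ → γ < 1 / 2 → 1 ≤ d → 1 ≤ m →
        (p : ℝ) ≤ min (c / γ ^ 2) (Real.exp (c * d)) / R →
        (t : ℝ) ≤ Real.exp (c * R * d) →
        ∀ (X : Type*) [Fintype X], Fintype.card X = 2 * m →
        ∀ (Ω : Type*) [MeasurableSpace Ω] (μ : Measure Ω) [IsProbabilityMeasure μ]
          (A : BoostingAlgorithm Ω X m p t),
        ∃ (H : Set (Hypothesis X)) (D : LabeledDist X) (W : Oracle X),
          HasVCDim H (min ⌊(d : ℝ) / c⌋₊ (2 * m)) ∧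
          Realizable H D ∧
          IsWeakLearner γ H W ∧
          Real.exp (-(C * (p * γ ^ 2 * R + 1))) ≤ A.expectedLoss μ D W := by
  refine ⟨1 / 2000, by norm_num, 4, by norm_num, ?_⟩
  intro R γ d m p t hR hγ _ hd hm hp ht X _ hX Ω _ μ _ A
  classical
  have hd' : (1 : ℝ) ≤ d := by exact_mod_cast hd
  have : Nonempty X := Fintype.card_pos_iff.1 (by omega)
  have hfloor : ⌊(d : ℝ) / (1 / 2000)⌋₊ = 2000 * d := by
    have : (d : ℝ) / (1 / 2000) = (2000 * d : ℕ) := by push_cast; ring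
    rw [this, Nat.floor_natCast]
  have hC : Real.exp (-(4 * (p * γ ^ 2 * R + 1))) ≤ 1 / 32 := by
    refine (Real.exp_le_exp.2 ?_).trans exp_neg_four_le
    have : 0 ≤ p * γ ^ 2 * R := by positivity
    linarith
  suffices ∃ (H : Set (Hypothesis X)) (D : LabeledDist X) (W : Oracle X),
      HasVCDim H (min (2000 * d) (2 * m)) ∧ Realizable H D ∧ IsWeakLearner γ H W ∧
        1 / 32 ≤ A.expectedLoss μ D W by
    obtain ⟨H, D, W, h1, h2, h3, h4⟩ := this
    exact ⟨H, D, W, hfloor ▸ h1, h2, h3, hC.trans h4⟩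
  have hk : min (2000 * d) (2 * m) ≤ Fintype.card X := hX ▸ min_le_right _ _
  -- Without rounds the hypotheses do not force `γ ≤ 1/12`, but then no blocks are needed and `δ =
  -- 1` is harmless.
  rcases Nat.eq_zero_or_pos p with rfl | hp1
  · refine exists_class_le_expectedLoss (J := Fin 0) (δ := 1) (θ := fun _ => 0) A μ hX
      (fun _ => le_rfl) (fun _ => zero_le_one) (fun c q _ => ?_) (by simp) (by norm_num) hk
      (Or.inr ?_)
    · rw [← sum_blockLaw (fun _ : Fin 0 => (0 : ℝ)) c]
      exact Finset.sum_le_univ_sum_of_nonneg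
        (blockLaw_nonneg (fun _ => le_rfl) (fun _ => zero_le_one) c)
    · simp
  have hp1' : (1 : ℝ) ≤ p := by exact_mod_cast hp1
  rw [le_div_iff₀ (by linarith)] at hp
  have hpγ : p * R * γ ^ 2 ≤ 1 / 2000 := by
    rw [← le_div_iff₀ (by positivity)]; exact hp.trans (min_le_left _ _)
  have hpR : p * R ≤ Real.exp (1 / 2000 * d) := hp.trans (min_le_right _ _)
  have hpR1 : 1 ≤ p * R := one_le_mul_of_one_le_of_one_le hp1' hR
  have hγ2 : γ ^ 2 ≤ 1 / 2000 := by nlinarith [sq_nonneg γ]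
  have hγ1 : γ ≤ 1 / 12 := by nlinarith
  have hr := Nat.le_ceil R
  have hr' := (Nat.ceil_lt_add_one (by linarith : 0 ≤ R)).le
  have hn := Nat.le_ceil (R * (5 * d * Real.exp (650 * d)))
  have hn' := (Nat.ceil_lt_add_one
    (by positivity : 0 ≤ R * (5 * d * Real.exp (650 * d)))).le
  set r := ⌈R⌉₊
  set n := ⌈R * (5 * d * Real.exp (650 * d))⌉₊
  refine exists_class_le_expectedLoss (J := Fin r ⊕ Fin n) (δ := Real.exp (-(5 * d * R)))
    (θ := Sum.elim (fun _ => 6 * γ) fun _ => 0) A μ hX ?_ ?_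
    (sum_blockLaw_fails_le hd hγ hγ1 hr hn) ?_ ?_ hk ?_
  · rintro (_ | _)
    · simpa using hγ.le
    · simp
  · rintro (_ | _)
    · simp only [Sum.elim_inl]; linarith
    · simp
  · have hpe : (p : ℝ) ≤ Real.exp (1 / 2000 * d) := le_trans (by nlinarith) hpR
    calc (p : ℝ) * (t * Real.exp (-(5 * d * R)))
        ≤ Real.exp (1 / 2000 * d) * (Real.exp (1 / 2000 * R * d) * Real.exp (-(5 * d * R))) := by
          gcongr
      _ = Real.exp (1 / 2000 * d + (1 / 2000 * R * d + -(5 * d * R))) := by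
          rw [Real.exp_add, Real.exp_add]
      _ ≤ Real.exp (-4) := Real.exp_le_exp.2 (by nlinarith)
      _ ≤ 1 / 32 := exp_neg_four_le
  · have e : (∏ j : Fin r ⊕ Fin n, (1 - Sum.elim (fun _ => 6 * γ) (fun _ => 0) j ^ 2)) ^ p =
        (1 + -(36 * γ ^ 2)) ^ (r * p) := by
      rw [pow_mul, Fintype.prod_sum_type]
      simp
      ring
    rw [e]
    -- Bernoulli's inequality; the loss is `36 r p γ² ≤ 72 p R γ² ≤ 72/2000`, from `r ≤ R + 1 ≤ 2R`.
    refine le_trans ?_ (one_add_mul_le_pow (by linarith) _)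
    push_cast
    have : (r : ℝ) * p * γ ^ 2 ≤ 2 * (p * R * γ ^ 2) := by
      have : (r : ℝ) * (p * γ ^ 2) ≤ (2 * R) * (p * γ ^ 2) :=
        mul_le_mul_of_nonneg_right (by linarith) (by positivity)
      linarith
    linarith
  · rcases le_total (2 * m) (2000 * d) with h | h
    · left; rw [min_eq_right h, hX]
    · right
      rw [min_eq_left h, Fintype.card_sum, Fintype.card_fin, Fintype.card_fin]
      exact card_blocks_lt hd hR hpR hr' hn'
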